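/- Let $V:\mathbb R^3\to S^2$ be a continuous unit vector field defining a fibration of $\mathbb R^3$ by oriented lines, i.e. for every $p\in\mathbb R^3$ the oriented line $t\mapsto p+tV(p)$ is an integral curve of $V$ (equivalently, $V(p+tV(p))=V(p)$ for all $t\in\mathbb R$); these lines are the fibers. Let $U=V(\mathbb R^3)\subset S^2$, and for $u\in U$ let $S_u=u^\perp\cap V^{-1}(u)$, where $u^\perp$ is the plane through the origin orthogonal to $u$. The fibration is called 1-parameter if there is a linear plane $P\subset\mathbb R^3$ such that for every plane parallel to $P$ (including $P$ itself), the fiber through each point of that plane is contained in it. Continuity at infinity holds for $u\in U$ if for every sequence $(p_n)$ in $\mathbb R^3$ with $|p_n|\to\infty$ and $p_n/|p_n|\to\pm u$ (i.e. converging to the class of $u$ in $\mathbb{RP}^2$) one has $V(p_n)\to u$. A subset of $S^2$ is convex if it contains the shorter great-circle arc between any two of its non-antipodal points. Then: (a) If the fibration is not 1-parameter, then for every $u\in U$ the set $S_u$ is convex (in particular, connected). (b) If $u\in U$ and $S_u$ is compact, then continuity at infinity holds for $u$, and $-u\notin U$. (c) If $S_u$ is compact for every $u\in U$, then $U$ is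 a convex subset of $S^2$. (d) If $S_u$ is non-compact for every $u\in U$, then every $S_u$ ($u\in U$) is a union of one or more lines, and the fibration is 1-parameter. -/

import Mathlib

open Filter Topology

namespace LineFibration

/-- Euclidean three-space. -/
abbrev E3 : Type := EuclideanSpace ℝ (Fin 3)

/-- The unit sphere `S²` of `ℝ³`. -/
abbrev S2 : Type := Metric.sphere (0 : E3) 1

/-- The line through `p` in the direction `V p`, oriented by `V p`. -/
def fiber (V : E3 → S2) (p : E3) : Set E3 :=
  Set.range fun t : ℝ => p + t • (V p : E3)

/-- `V` gives a fibration of `ℝ³` by oriented lines: it is a continuous unit vector field and, for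
every point `p`, the oriented line `t ↦ p + t V(p)` is an integral curve of `V`
(its velocity `V p` is the value of `V` at each of its points). -/
structure IsLineFibration (V : E3 → S2) : Prop where
  continuous : Continuous V
  integral : ∀ (p : E3) (t : ℝ), V (p + t • (V p : E3)) = V p

/-- The set `U = V(ℝ³)` of fiber directions. -/
def directions (V : E3 → S2) : Set S2 := Set.range V

/-- The base space `S_u = u^⊥ ∩ V⁻¹(u)`. -/
def baseSpace (V : E3 → S2) (u : S2) : Set E3 :=
  ((ℝ ∙ (u : E3))ᗮ : Set E3) ∩ V ⁻¹' {u}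

/-- A fibration is 1-parameter if, for some linear plane `P`, every plane parallel to `P` is
itself fibered by fibers of the fibration: the fiber through each point of such a plane is
contained in it. -/
def IsOneParameter (V : E3 → S2) : Prop :=
  ∃ P : Submodule ℝ E3, Module.finrank ℝ P = 2 ∧
    ∀ a : E3, ∀ p ∈ AffineSubspace.mk' a P, fiber V p ⊆ (AffineSubspace.mk' a P : Set E3)

/-- Continuity at infinity for the direction `u`: if `|p_n| → ∞` and `p_n / |p_n| → ±u`, then
`V(p_n) → u`. Convergence to `±u` means that every neighborhood of the pair `{u, -u}` contains
`p_n / |p_n|` for all large `n`, i.e. convergence in the projective plane. -/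
def ContinuityAtInfinity (V : E3 → S2) (u : S2) : Prop :=
  ∀ p : ℕ → E3, Tendsto (fun n => ‖p n‖) atTop atTop →
    Tendsto (fun n => ‖p n‖⁻¹ • p n) atTop (𝓝 (u : E3) ⊔ 𝓝 (-(u : E3))) →
    Tendsto (fun n => V (p n)) atTop (𝓝 u)

/-- Convexity of a subset of `S²`: it contains the shorter great-circle arc between any two of its
non-antipodal points. The points of this arc are the unit vectors which are combinations of the
two endpoints with nonnegative coefficients. -/
def IsSphericallyConvex (K : Set S2) : Prop :=
  ∀ u ∈ K, ∀ v ∈ K, v ≠ -u → ∀ w : S2, ∀ a b : ℝ, 0 ≤ a → 0 ≤ b →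
    (w : E3) = a • (u : E3) + b • (v : E3) → w ∈ K

/-- `A` is a union of one or more (affine) lines. -/
def IsUnionOfLines (A : Set E3) : Prop :=
  ∃ L : Set (AffineSubspace ℝ E3), L.Nonempty ∧
    (∀ l ∈ L, (l : Set E3).Nonempty ∧ Module.finrank ℝ l.direction = 1) ∧
    A = ⋃ l ∈ L, (l : Set E3)

end LineFibration

/-! Call a fibration planar if `V` is orthogonal to a fixed nonzero vector; this makes it
1-parameter, and the proof works with planarity throughout. The basic fact is that disjoint coplanar
lines are parallel.

Convexity of base spaces: fix `u`, and call fibers parallel to `u` vertical. If vertical fibers in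
one plane leave a gap, they bound a strip crossed only by transverse fibers. Unless the fibration is
planar, these fibers fill exactly the non-vertical points (`mem_swept_of_not_vert`). Project fibers
along `u`: the slope of the projection is then monotone along each vertical line, in the same sense
everywhere. The behaviour near an edge of the strip excludes one of the two senses, and two edges
with the same direction exclude both (`isPlanar_of_eq`). Hence a gap between two fibers of direction
`u` cannot occur.

Compact base spaces: if also `-u` were a direction, the strip between the two kinds of fiber would
leave a whole ray of `S_u` outside it. For continuity at infinity, fibers through the boundary of a
neighborhood of `S_u` diverge linearly, so by connectedness fibers starting inside cover a cone
(`exists_cone_bound`). For convexity of `U`, take planes parallel to two directions `u` and `v`.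
Each contains a fiber, whose direction depends continuously on the plane. This gives a curve in one
great circle with image in `U`, passing through `u` and `v`; since it avoids `-v`, it must traverse
the shorter arc.

Noncompact base spaces: if the fibration is not planar, each `S_u` is closed, convex, unbounded and
contains no line, so its recession directions lie strictly on one side. Choose the compact face of
`S_u` extremal in that direction and a path just behind it. Every point of the path has a recession
ray of its own base space that must pass the face on one side or the other. By connectedness some
point has such passages on both sides, and convexity puts the face into the wrong base space. -/

open scoped RealInnerProductSpace

namespace LineFibration

variable {V : E3 → S2} {u e n p : E3} {ℓ : ℝ}

/-! ### Orthonormal frames -/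

/-- `u, e, n` is an orthonormal frame of `E3`. -/
structure IsFrame (u e n : E3) : Prop where
  uu : ⟪u, u⟫ = 1
  ee : ⟪e, e⟫ = 1
  nn : ⟪n, n⟫ = 1
  ue : ⟪u, e⟫ = 0
  un : ⟪u, n⟫ = 0
  en : ⟪e, n⟫ = 0

namespace IsFrame

lemma eu (h : IsFrame u e n) : ⟪e, u⟫ = 0 := by rw [real_inner_comm]; exact h.ue
lemma nu (h : IsFrame u e n) : ⟪n, u⟫ = 0 := by rw [real_inner_comm]; exact h.un
lemma ne (h : IsFrame u e n) : ⟪n, e⟫ = 0 := by rw [real_inner_comm]; exact h.en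

lemma norm_u (h : IsFrame u e n) : ‖u‖ = 1 := by
  rw [norm_eq_sqrt_real_inner, h.uu, Real.sqrt_one]
lemma norm_e (h : IsFrame u e n) : ‖e‖ = 1 := by
  rw [norm_eq_sqrt_real_inner, h.ee, Real.sqrt_one]
lemma norm_n (h : IsFrame u e n) : ‖n‖ = 1 := by
  rw [norm_eq_sqrt_real_inner, h.nn, Real.sqrt_one]

lemma neg_right (h : IsFrame u e n) : IsFrame u e (-n) := by
  constructor <;> simp [h.ue, h.un, h.en, h.norm_u, h.norm_e, h.norm_n]

lemma neg_mid (h : IsFrame u e n) : IsFrame u (-e) n := by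
  constructor <;> simp [h.ue, h.un, h.en, h.norm_u, h.norm_e, h.norm_n]

lemma orthonormal (h : IsFrame u e n) : Orthonormal ℝ ![u, e, n] := by
  rw [orthonormal_iff_ite]
  intro i j
  fin_cases i <;> fin_cases j <;>
    simp [h.uu, h.ee, h.nn, h.ue, h.un, h.en, h.eu, h.nu, h.ne,
      -inner_self_eq_norm_sq_to_K]

lemma expand (h : IsFrame u e n) (y : E3) :
    y = ⟪y, u⟫ • u + ⟪y, e⟫ • e + ⟪y, n⟫ • n := by
  have hc : Fintype.card (Fin 3) = Module.finrank ℝ E3 := by simp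
  let b := basisOfOrthonormalOfCardEqFinrank h.orthonormal hc
  have hb : ⇑b = ![u, e, n] := coe_basisOfOrthonormalOfCardEqFinrank _ _
  let B := b.toOrthonormalBasis (by rw [hb]; exact h.orthonormal)
  have hB : ⇑B = ![u, e, n] := by simp [B, hb]
  have := B.sum_repr' y
  rw [Fin.sum_univ_three, hB] at this
  simp only [Matrix.cons_val_zero, Matrix.cons_val_one, Matrix.cons_val] at this
  rw [real_inner_comm, real_inner_comm y e, real_inner_comm y n] at this
  exact this.symm

lemma ext (h : IsFrame u e n) {y y' : E3} (h1 : ⟪y, u⟫ = ⟪y', u⟫)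
    (h2 : ⟪y, e⟫ = ⟪y', e⟫) (h3 : ⟪y, n⟫ = ⟪y', n⟫) : y = y' := by
  rw [h.expand y, h.expand y', h1, h2, h3]

lemma inner_self (h : IsFrame u e n) (y : E3) :
    ⟪y, y⟫ = ⟪y, u⟫ ^ 2 + ⟪y, e⟫ ^ 2 + ⟪y, n⟫ ^ 2 := by
  conv_lhs => rw [h.expand y]
  simp only [inner_add_left, inner_add_right, real_inner_smul_left, real_inner_smul_right,
    h.uu, h.ee, h.nn, h.ue, h.un, h.en, h.eu, h.nu, h.ne]
  ring

lemma e_ne (h : IsFrame u e n) : e ≠ 0 := by rintro rfl; simpa using h.ee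
lemma n_ne (h : IsFrame u e n) : n ≠ 0 := by rintro rfl; simpa using h.nn

end IsFrame

lemma exists_frame {u e : E3} (uu : ⟪u, u⟫ = 1) (ee : ⟪e, e⟫ = 1) (ue : ⟪u, e⟫ = 0) :
    ∃ n, IsFrame u e n := by
  let K : Submodule ℝ E3 := Submodule.span ℝ {u, e}
  have hK : Module.finrank ℝ K ≤ 2 := by
    have := finrank_span_finset_le_card (R := ℝ) ({u, e} : Finset E3)
    simp only [Finset.coe_insert, Finset.coe_singleton] at this
    exact this.trans Finset.card_le_two
  have h3 : Module.finrank ℝ K + Module.finrank ℝ Kᗮ = 3 := by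
    rw [Submodule.finrank_add_finrank_orthogonal]; simp
  have hne : Kᗮ ≠ ⊥ := by
    intro h0
    rw [h0, finrank_bot] at h3
    omega
  obtain ⟨m, hm, hm0⟩ := Submodule.exists_mem_ne_zero_of_ne_bot hne
  rw [Submodule.mem_orthogonal] at hm
  have h1 := hm u (Submodule.subset_span (by simp))
  have h2 := hm e (Submodule.subset_span (by simp))
  refine ⟨‖m‖⁻¹ • m, uu, ee, ?_, ue, ?_, ?_⟩
  · rw [real_inner_smul_left, real_inner_smul_right, real_inner_self_eq_norm_sq]
    have : ‖m‖ ≠ 0 := norm_ne_zero_iff.2 hm0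
    field_simp
  · rw [real_inner_smul_right, h1, mul_zero]
  · rw [real_inner_smul_right, h2, mul_zero]

lemma inner_self_coe (u : S2) : ⟪(u : E3), (u : E3)⟫ = 1 := by
  rw [real_inner_self_eq_norm_sq, norm_eq_of_mem_sphere]; norm_num

/-- A nonzero vector orthogonal to `u` spans, together with `u`, the plane of a frame. -/
lemma exists_frame_of_orthogonal {u d : E3} (uu : ⟪u, u⟫ = 1) (hd : d ≠ 0)
    (ud : ⟪u, d⟫ = 0) : ∃ e n, IsFrame u e n ∧ d = ‖d‖ • e := by
  have hd' : ‖d‖ ≠ 0 := norm_ne_zero_iff.2 hd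
  obtain ⟨n, hn⟩ := exists_frame (u := u) (e := ‖d‖⁻¹ • d) uu
    (by rw [real_inner_smul_left, real_inner_smul_right, real_inner_self_eq_norm_sq]; field_simp)
    (by rw [real_inner_smul_right, ud, mul_zero])
  refine ⟨_, n, hn, ?_⟩
  rw [smul_smul, mul_inv_cancel₀ hd', one_smul]


/-! ### Planar fibrations and coplanar fibers -/

/-- `V` is orthogonal to a fixed nonzero vector. -/
def IsPlanar (V : E3 → S2) : Prop := ∃ n : E3, n ≠ 0 ∧ ∀ y, ⟪(V y : E3), n⟫ = 0

lemma IsPlanar.isOneParameter (h : IsPlanar V) : IsOneParameter V := by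
  obtain ⟨n, hn, h⟩ := h
  refine ⟨(ℝ ∙ n)ᗮ, ?_, ?_⟩
  · have h3 : Module.finrank ℝ (ℝ ∙ n) + Module.finrank ℝ (ℝ ∙ n)ᗮ = 3 := by
      rw [Submodule.finrank_add_finrank_orthogonal]; simp
    rw [finrank_span_singleton hn] at h3
    omega
  · rintro a p hp _ ⟨t, rfl⟩
    rw [SetLike.mem_coe]
    rw [AffineSubspace.mem_mk', vsub_eq_sub] at hp ⊢
    have : p + t • (V p : E3) - a = (p - a) + t • (V p : E3) := by abel
    rw [this]
    refine Submodule.add_mem _ hp (Submodule.smul_mem _ _ ?_)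
    rw [Submodule.mem_orthogonal_singleton_iff_inner_left]
    exact h p

namespace IsLineFibration

lemma continuous_coe (hV : IsLineFibration V) : Continuous fun y => (V y : E3) :=
  continuous_subtype_val.comp hV.continuous

lemma continuous_inner (hV : IsLineFibration V) (n : E3) :
    Continuous fun y => ⟪(V y : E3), n⟫ :=
  hV.continuous_coe.inner continuous_const

/-- Coplanar fibers which are not parallel meet, which is impossible. -/
lemma eq_of_sub_eq (hV : IsLineFibration V) {p q : E3} {a b : ℝ}
    (h : q - p = a • (V p : E3) + b • (V q : E3)) : V p = V q := by
  have h1 : p + a • (V p : E3) = q + (-b) • (V q : E3) := by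
    linear_combination (norm := module) (-1 : ℝ) • h
  rw [← hV.integral p a, h1, hV.integral]

/-- A fiber transverse to the plane would cross it, and `V` at the crossing point is the same vector
as at the starting point. -/
lemma isPlanar_of_plane (hV : IsLineFibration V) {n : E3} (hn : n ≠ 0) (p : E3)
    (h : ∀ y, ⟪y - p, n⟫ = 0 → ⟪(V y : E3), n⟫ = 0) : IsPlanar V := by
  refine ⟨n, hn, fun y => ?_⟩
  by_contra hy
  apply hy
  rw [← hV.integral y (-(⟪y - p, n⟫ / ⟪(V y : E3), n⟫))]
  apply h
  simp only [inner_sub_left, inner_add_left, real_inner_smul_left]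
  field_simp
  ring

end IsLineFibration

/-! ### Vertical fibers -/

/-- The fiber through `y` is parallel to `u`. -/
def Vert (V : E3 → S2) (u : E3) (y : E3) : Prop := (V y : E3) = u ∨ (V y : E3) = -u

lemma vert_iff {u e n : E3} (hF : IsFrame u e n) (y : E3) :
    Vert V u y ↔ ⟪(V y : E3), e⟫ = 0 ∧ ⟪(V y : E3), n⟫ = 0 := by
  constructor
  · rintro (h | h) <;> rw [h] <;> simp [hF.ue, hF.un]
  · rintro ⟨h1, h2⟩
    have h := hF.inner_self (V y)
    rw [inner_self_coe, h1, h2] at h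
    have h3 : ⟪(V y : E3), u⟫ = 1 ∨ ⟪(V y : E3), u⟫ = -1 := by
      rw [← sq_eq_one_iff]; linarith
    have hx := hF.expand (V y)
    rw [h1, h2] at hx
    rcases h3 with h3 | h3 <;> rw [h3] at hx
    · left; simpa using hx
    · right; simpa using hx

lemma Vert.add_smul (hV : IsLineFibration V) {y : E3} (h : Vert V u y) (z : ℝ) :
    V (y + z • u) = V y := by
  rcases h with h | h
  · rw [← h, hV.integral]
  · have : z • u = (-z) • (V y : E3) := by rw [h]; module
    rw [this, hV.integral]

lemma vert_add_smul_iff (hV : IsLineFibration V) {y : E3} (z : ℝ) :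
    Vert V u (y + z • u) ↔ Vert V u y := by
  constructor
  · intro h
    have h1 := h.add_smul hV (-z)
    have h2 : y + z • u + (-z) • u = y := by module
    rw [h2] at h1
    unfold Vert
    rwa [h1]
  · intro h
    have h1 := h.add_smul hV z
    unfold Vert
    rwa [h1]

lemma vert_add_fiber_iff (hV : IsLineFibration V) {y : E3} (t : ℝ) :
    Vert V u (y + t • (V y : E3)) ↔ Vert V u y := by
  unfold Vert
  rw [hV.integral]

lemma isOpen_not_vert (hV : IsLineFibration V) (u : E3) : IsOpen {y | ¬ Vert V u y} := by
  rw [← isClosed_compl_iff]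
  have : {y | ¬ Vert V u y}ᶜ = {y | (V y : E3) = u} ∪ {y | (V y : E3) = -u} := by
    ext y; simp [Vert, or_iff_not_imp_left]
  rw [this]
  exact (isClosed_eq hV.continuous_coe continuous_const).union
    (isClosed_eq hV.continuous_coe continuous_const)

/-- A fiber meeting a plane through a vertical fiber is vertical or transverse to it. -/
lemma inner_ne_zero_of_coplanar (hV : IsLineFibration V) (hF : IsFrame u e n) (hp : Vert V u p)
    {y : E3} (hy : ¬ Vert V u y) (h : ⟪y - p, n⟫ = 0) : ⟪(V y : E3), n⟫ ≠ 0 := by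
  intro hn
  have he : ⟪(V y : E3), e⟫ ≠ 0 := fun he => hy ((vert_iff hF y).2 ⟨he, hn⟩)
  apply hy
  have h1 := hF.expand (V y)
  have h2 := hF.expand (y - p)
  rw [hn] at h1
  rw [h] at h2
  have key : V p = V y := by
    set α := ⟪(V y : E3), u⟫
    set β := ⟪(V y : E3), e⟫
    set x := ⟪y - p, e⟫
    set z := ⟪y - p, u⟫
    rcases hp with hp | hp
    · refine hV.eq_of_sub_eq (a := z - x * α / β) (b := x / β) ?_
      rw [hp, h2, h1]
      match_scalars <;> field_simp <;> ring
    · refine hV.eq_of_sub_eq (a := -(z - x * α / β)) (b := x / β) ?_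
      rw [hp, h2, h1]
      match_scalars <;> field_simp <;> ring
  unfold Vert at *
  rwa [← key]

/-! ### Strips and the fibers that cross them -/

/-- A strip bounded by two fibers parallel to `u`, none of whose interior points lies on a fiber
parallel to `u`. -/
structure IsStrip (V : E3 → S2) (u e n p : E3) (ℓ : ℝ) : Prop where
  frame : IsFrame u e n
  pos : 0 < ℓ
  left : Vert V u p
  right : Vert V u (p + ℓ • e)
  mid : ∀ x, 0 < x → x < ℓ → ¬ Vert V u (p + x • e)

/-- The slope of the projection along `u` of the fiber through `y`. -/
noncomputable def slope (V : E3 → S2) (e n y : E3) : ℝ := ⟪(V y : E3), e⟫ / ⟪(V y : E3), n⟫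

/-- The `e`-coordinate of the intersection of the fiber through `y` with the plane `n = 0`
through `p`. -/
noncomputable def crossing (V : E3 → S2) (e n p y : E3) : ℝ :=
  ⟪y - p, e⟫ - ⟪y - p, n⟫ * slope V e n y

/-- The union of the fibers which cross the open strip transversally. -/
def swept (V : E3 → S2) (e n p : E3) (ℓ : ℝ) : Set E3 :=
  {y | ⟪(V y : E3), n⟫ ≠ 0 ∧ 0 < crossing V e n p y ∧ crossing V e n p y < ℓ}

lemma continuousAt_slope (hV : IsLineFibration V) {y : E3} (h : ⟪(V y : E3), n⟫ ≠ 0) :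
    ContinuousAt (slope V e n) y :=
  (hV.continuous_inner e).continuousAt.div (hV.continuous_inner n).continuousAt h

lemma continuousAt_crossing (hV : IsLineFibration V) {y : E3} (h : ⟪(V y : E3), n⟫ ≠ 0) :
    ContinuousAt (crossing V e n p) y := by
  have h1 : Continuous fun y : E3 => ⟪y - p, e⟫ := by fun_prop
  have h2 : Continuous fun y : E3 => ⟪y - p, n⟫ := by fun_prop
  exact h1.continuousAt.sub (h2.continuousAt.mul (continuousAt_slope hV h))

lemma isOpen_swept (hV : IsLineFibration V) : IsOpen (swept V e n p ℓ) := by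
  rw [isOpen_iff_mem_nhds]
  rintro y ⟨h1, h2, h3⟩
  have hc := continuousAt_crossing (e := e) (p := p) hV h1
  filter_upwards [(hV.continuous_inner n).continuousAt.eventually_ne h1,
    hc.eventually (lt_mem_nhds h2), hc.eventually (gt_mem_nhds h3)] with z hz1 hz2 hz3
  exact ⟨hz1, hz2, hz3⟩

lemma slope_fiber (hV : IsLineFibration V) (y : E3) (t : ℝ) :
    slope V e n (y + t • (V y : E3)) = slope V e n y := by
  unfold slope
  rw [hV.integral]

lemma crossing_fiber (hV : IsLineFibration V) {y : E3} (h : ⟪(V y : E3), n⟫ ≠ 0) (t : ℝ) :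
    crossing V e n p (y + t • (V y : E3)) = crossing V e n p y := by
  unfold crossing
  rw [slope_fiber hV]
  unfold slope
  simp only [inner_add_left, inner_sub_left, real_inner_smul_left]
  field_simp
  ring

lemma swept_fiber (hV : IsLineFibration V) {y : E3} (h : y ∈ swept V e n p ℓ) (t : ℝ) :
    y + t • (V y : E3) ∈ swept V e n p ℓ := by
  refine ⟨?_, ?_⟩
  · rw [hV.integral]; exact h.1
  · rw [crossing_fiber hV h.1]; exact h.2

lemma exists_foot (hF : IsFrame u e n) (p : E3) {y : E3}
    (h : ⟪(V y : E3), n⟫ ≠ 0) :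
    ∃ t z : ℝ, y + t • (V y : E3) = p + crossing V e n p y • e + z • u := by
  refine ⟨-(⟪y - p, n⟫ / ⟪(V y : E3), n⟫),
    ⟪y - p, u⟫ - ⟪y - p, n⟫ / ⟪(V y : E3), n⟫ * ⟪(V y : E3), u⟫, ?_⟩
  unfold crossing slope
  apply hF.ext <;>
    simp only [inner_add_left, inner_sub_left, real_inner_smul_left, hF.uu, hF.ee, hF.ue, hF.eu,
      hF.un, hF.en] <;> field_simp <;> ring

namespace IsStrip

lemma inner_ne_zero (hV : IsLineFibration V) (hS : IsStrip V u e n p ℓ) {x : ℝ} (h0 : 0 < x)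
    (h1 : x < ℓ) (z : ℝ) : ⟪(V (p + x • e + z • u) : E3), n⟫ ≠ 0 := by
  refine inner_ne_zero_of_coplanar hV hS.frame hS.left ?_ ?_
  · rw [vert_add_smul_iff hV]; exact hS.mid x h0 h1
  · simp [inner_add_left, inner_sub_left, real_inner_smul_left, hS.frame.en, hS.frame.un]

lemma crossing_strip (hF : IsFrame u e n) (x z : ℝ) :
    crossing V e n p (p + x • e + z • u) = x := by
  unfold crossing
  simp only [inner_add_left, inner_sub_left, real_inner_smul_left, hF.ee, hF.ue, hF.un, hF.en]
  ring

lemma mem_swept (hV : IsLineFibration V) (hS : IsStrip V u e n p ℓ) {x : ℝ} (h0 : 0 < x)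
    (h1 : x < ℓ) (z : ℝ) : p + x • e + z • u ∈ swept V e n p ℓ :=
  ⟨hS.inner_ne_zero hV h0 h1 z, by rwa [crossing_strip hS.frame],
    by rwa [crossing_strip hS.frame]⟩

lemma not_vert_of_mem_swept (hS : IsStrip V u e n p ℓ) {y : E3}
    (h : y ∈ swept V e n p ℓ) : ¬ Vert V u y :=
  fun hy => h.1 ((vert_iff hS.frame y).1 hy).2

/-- Limits of swept points which are not swept are vertical. -/
lemma eventually_not_mem_swept (hV : IsLineFibration V) (hS : IsStrip V u e n p ℓ) {y : E3}
    (hy : ¬ Vert V u y) (h : y ∉ swept V e n p ℓ) : ∀ᶠ y' in 𝓝 y, y' ∉ swept V e n p ℓ := by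
  have hF := hS.frame
  by_cases hn : ⟪(V y : E3), n⟫ = 0
  · have he : ⟪(V y : E3), e⟫ ≠ 0 := fun he => hy ((vert_iff hF y).2 ⟨he, hn⟩)
    have ht : ⟪y - p, n⟫ ≠ 0 := fun ht => inner_ne_zero_of_coplanar hV hF hS.left hy ht hn
    -- A swept point satisfies the reverse of the inequality below, because its crossing coordinate
    -- lies between `0` and `ℓ`. At `y` the left side vanishes and the right side does not, so the
    -- strict inequality persists nearby.
    have h1 : Continuous fun y : E3 => |⟪(V y : E3), n⟫| * (|⟪y - p, e⟫| + ℓ) :=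
      (hV.continuous_inner n).abs.mul (by fun_prop)
    have h2 : Continuous fun y : E3 => |⟪y - p, n⟫ * ⟪(V y : E3), e⟫| :=
      (Continuous.mul (by fun_prop) (hV.continuous_inner e)).abs
    have h3 : |⟪(V y : E3), n⟫| * (|⟪y - p, e⟫| + ℓ) < |⟪y - p, n⟫ * ⟪(V y : E3), e⟫| := by
      rw [hn, abs_zero, zero_mul, abs_pos]
      exact mul_ne_zero ht he
    filter_upwards [h1.continuousAt.eventually_lt h2.continuousAt h3] with y' hy'
    rintro ⟨hn', hx0, hx1⟩
    have hc : crossing V e n p y' * ⟪(V y' : E3), n⟫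
        = ⟪y' - p, e⟫ * ⟪(V y' : E3), n⟫ - ⟪y' - p, n⟫ * ⟪(V y' : E3), e⟫ := by
      unfold crossing slope
      field_simp
    have h4 : |⟪y' - p, n⟫ * ⟪(V y' : E3), e⟫|
        = |⟪(V y' : E3), n⟫| * |⟪y' - p, e⟫ - crossing V e n p y'| := by
      rw [← abs_mul]
      congr 1
      linarith
    have h5 : |⟪y' - p, e⟫ - crossing V e n p y'| ≤ |⟪y' - p, e⟫| + ℓ := by
      refine (abs_sub _ _).trans ?_
      rw [abs_of_pos hx0]
      linarith
    have h6 := mul_le_mul_of_nonneg_left h5 (abs_nonneg ⟪(V y' : E3), n⟫)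
    linarith
  · have hc := continuousAt_crossing (e := e) (p := p) hV hn
    -- The foot of the fiber is not vertical, so the crossing coordinate differs from `0` and `ℓ`;
    -- being outside the open interval, it stays outside under small perturbations.
    obtain ⟨t, z, hf⟩ := exists_foot hF p hn
    have hfv := (vert_add_fiber_iff (u := u) hV (y := y) t).not.2 hy
    rw [hf, vert_add_smul_iff hV] at hfv
    by_cases h0 : crossing V e n p y < 0
    · filter_upwards [hc.eventually (gt_mem_nhds h0)] with y' hy' h'
      exact absurd h'.2.1 (not_lt.2 hy'.le)
    by_cases h1 : ℓ < crossing V e n p y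
    · filter_upwards [hc.eventually (lt_mem_nhds h1)] with y' hy' h'
      exact absurd h'.2.2 (not_lt.2 hy'.le)
    exfalso
    rcases (not_lt.1 h0).eq_or_lt with h2 | h2
    · apply hfv
      rw [← h2, zero_smul, add_zero]
      exact hS.left
    rcases (not_lt.1 h1).eq_or_lt with h3 | h3
    · apply hfv
      rw [h3]
      exact hS.right
    exact h ⟨hn, h2, h3⟩

/-- Along the vertical line through `y` the swept heights form an open set. It is also closed, since
the line consists of non-vertical points, near which being unswept is stable. -/
lemma swept_add_smul (hV : IsLineFibration V) (hS : IsStrip V u e n p ℓ) {y : E3}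
    (h : y ∈ swept V e n p ℓ) (z : ℝ) : y + z • u ∈ swept V e n p ℓ := by
  let A : Set ℝ := {z | y + z • u ∈ swept V e n p ℓ}
  have hc : Continuous fun z : ℝ => y + z • u := by fun_prop
  have hA : IsClopen A := by
    refine ⟨⟨isOpen_iff_mem_nhds.2 fun w hw => ?_⟩, (isOpen_swept hV).preimage hc⟩
    have hv : ¬ Vert V u (y + w • u) :=
      (vert_add_smul_iff hV w).not.2 (hS.not_vert_of_mem_swept h)
    exact hc.continuousAt.eventually (hS.eventually_not_mem_swept hV hv hw)
  rcases isClopen_iff.1 hA with h0 | h0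
  · exact absurd (show (0 : ℝ) ∈ A by simpa [A] using h) (by rw [h0]; simp)
  · exact (Set.eq_univ_iff_forall.1 h0 z :)

/-- Unless the fibration is planar, the fibers crossing a strip fill the complement of the
vertical ones. -/
lemma mem_swept_of_not_vert (hV : IsLineFibration V) (hS : IsStrip V u e n p ℓ)
    (hP : ¬ IsPlanar V) {y : E3} (hy : ¬ Vert V u y) : y ∈ swept V e n p ℓ := by
  have hF := hS.frame
  by_contra hW
  apply hP
  set α := ⟪(V y : E3), e⟫ with hα
  set β := ⟪(V y : E3), n⟫ with hβ
  -- A normal to the plane spanned by `u` and `V y`. The plane through `y` with this normal misses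
  -- the swept set, so every swept fiber is parallel to it.
  set ν : E3 := β • e - α • n with hν
  have hαβ : α ≠ 0 ∨ β ≠ 0 := by
    by_contra! h
    exact hy ((vert_iff hF y).2 h)
  have hsq : 0 < α ^ 2 + β ^ 2 := by
    rcases hαβ with h | h <;> positivity
  have hν0 : ν ≠ 0 := by
    intro h0
    have h1 : ⟪ν, ν⟫ = 0 := by rw [h0]; simp
    rw [hν] at h1
    simp only [inner_sub_left, inner_sub_right, real_inner_smul_left, real_inner_smul_right,
      hF.ee, hF.nn, hF.en, hF.ne] at h1
    nlinarith
  have hinner : ∀ w : E3, ⟪w, ν⟫ = β * ⟪w, e⟫ - α * ⟪w, n⟫ := fun w => by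
    rw [hν, inner_sub_right, real_inner_smul_right, real_inner_smul_right]
  -- solving for a point of the plane orthogonal to `ν`
  have hsolve : ∀ w v : E3, ∀ c : ℝ, c ≠ 0 → ⟪v, e⟫ = c * α → ⟪v, n⟫ = c * β → ⟪w, ν⟫ = 0 →
      ∃ t z : ℝ, w = t • v + z • u := by
    intro w v c hc h1 h2 h3
    rw [hinner] at h3
    refine ⟨(⟪w, e⟫ * α + ⟪w, n⟫ * β) / (c * (α ^ 2 + β ^ 2)), ⟪w, u⟫ -
      (⟪w, e⟫ * α + ⟪w, n⟫ * β) / (c * (α ^ 2 + β ^ 2)) * ⟪v, u⟫, ?_⟩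
    apply hF.ext <;>
      simp only [inner_add_left, real_inner_smul_left, hF.uu, hF.ue, hF.un, h1, h2]
    · ring
    · field_simp
      linear_combination c * β * h3
    · field_simp
      linear_combination -c * α * h3
  have hnot : ∀ t z : ℝ, y + t • (V y : E3) + z • u ∉ swept V e n p ℓ := by
    intro t z h
    apply hW
    have h1 := hS.swept_add_smul hV h (-z)
    have h2 : y + t • (V y : E3) + z • u + (-z) • u = y + t • (V y : E3) := by module
    rw [h2] at h1
    have h3 := swept_fiber hV h1 (-t)
    rw [hV.integral] at h3
    have h4 : y + t • (V y : E3) + (-t) • (V y : E3) = y := by module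
    rwa [h4] at h3
  have hside : ∀ w ∈ swept V e n p ℓ, ⟪w - y, ν⟫ ≠ 0 := by
    intro w hw h0
    obtain ⟨t, z, h⟩ := hsolve (w - y) (V y) 1 one_ne_zero (by rw [one_mul]) (by rw [one_mul]) h0
    apply hnot t z
    rwa [add_assoc, ← h, add_sub_cancel]
  have hpar : ∀ w ∈ swept V e n p ℓ, ⟪(V w : E3), ν⟫ = 0 := by
    intro w hw
    by_contra h0
    apply hside _ (swept_fiber hV hw (-(⟪w - y, ν⟫ / ⟪(V w : E3), ν⟫)))
    simp only [inner_add_left, inner_sub_left, real_inner_smul_left]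
    field_simp
    ring
  -- The parallel plane through the middle of the strip is spanned by `u` and the fiber there.
  -- Invariance along fibers and along `u` makes it entirely swept, so all fibers meeting it lie in
  -- it.
  have hm := hS.mem_swept hV (half_pos hS.pos) (half_lt_self hS.pos) 0
  set r := p + (ℓ / 2) • e + (0 : ℝ) • u with hr
  refine hV.isPlanar_of_plane hν0 r fun w hw => hpar w ?_
  have hr0 := hpar r hm
  rw [hinner] at hr0
  obtain ⟨t, z, h⟩ := hsolve (w - r) (V r)
    ((⟪(V r : E3), e⟫ * α + ⟪(V r : E3), n⟫ * β) / (α ^ 2 + β ^ 2)) (by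
      intro hc
      rw [div_eq_zero_iff, or_iff_left hsq.ne'] at hc
      have : (α ^ 2 + β ^ 2) * ⟪(V r : E3), n⟫ = 0 := by
        linear_combination β * hc - α * hr0
      exact hm.1 ((mul_eq_zero.1 this).resolve_left hsq.ne'))
    (by field_simp; linear_combination β * hr0) (by field_simp; linear_combination -α * hr0) hw
  have h1 := hS.swept_add_smul hV (swept_fiber hV hm t) z
  rwa [add_assoc, ← h, add_sub_cancel] at h1

/-- A point of the plane of the strip is its own crossing point, so outside the open strip it is not
swept. -/
lemma vert_of_coplanar (hV : IsLineFibration V) (hS : IsStrip V u e n p ℓ)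
    (hP : ¬ IsPlanar V) {x : ℝ} (hx : x ≤ 0 ∨ ℓ ≤ x) : Vert V u (p + x • e) := by
  by_contra h
  have h1 := (hS.mem_swept_of_not_vert hV hP h).2
  have h2 := crossing_strip (V := V) (p := p) hS.frame x 0
  rw [zero_smul, add_zero] at h2
  rw [h2] at h1
  rcases hx with hx | hx <;> linarith

end IsStrip

/-! ### Vertical points on a line: gaps and constant orientation -/

/-- If all fibers meeting a line orthogonal to `u` are parallel to `u`, the fibration is planar. -/
lemma isPlanar_of_line (hV : IsLineFibration V) (hF : IsFrame u e n) (p : E3)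
    (h : ∀ x : ℝ, Vert V u (p + x • e)) : IsPlanar V := by
  refine hV.isPlanar_of_plane hF.n_ne p fun y hy => ?_
  have h1 := hF.expand (y - p)
  rw [hy] at h1
  have h2 : y = p + ⟪y - p, e⟫ • e + ⟪y - p, u⟫ • u := by
    linear_combination (norm := module) (1 : ℝ) • h1
  have h3 : Vert V u y := by
    rw [h2, vert_add_smul_iff hV]
    exact h _
  exact ((vert_iff hF y).1 h3).2

lemma exists_gap {F : Set ℝ} (hF : IsClosed F) {a b c : ℝ} (ha : a ∈ F) (hb : b ∈ F) (hc : c ∉ F)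
    (hac : a ≤ c) (hcb : c ≤ b) :
    ∃ x₁ ∈ F, ∃ x₂ ∈ F, a ≤ x₁ ∧ x₁ < x₂ ∧ x₂ ≤ b ∧ ∀ x, x₁ < x → x < x₂ → x ∉ F := by
  obtain ⟨x₁, h1, h1'⟩ := ((isCompact_Icc (a := a) (b := c)).inter_left hF).exists_isGreatest
    ⟨a, ha, le_rfl, hac⟩
  obtain ⟨x₂, h2, h2'⟩ := ((isCompact_Icc (a := c) (b := b)).inter_left hF).exists_isLeast
    ⟨b, hb, hcb, le_rfl⟩
  have h3 : x₁ < c := lt_of_le_of_ne h1.2.2 fun h => hc (h ▸ h1.1)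
  have h4 : c < x₂ := lt_of_le_of_ne h2.2.1 fun h => hc (h ▸ h2.1)
  refine ⟨x₁, h1.1, x₂, h2.1, h1.2.1, h3.trans h4, h2.2.2, fun x hx1 hx2 hx => ?_⟩
  rcases le_total x c with h | h
  · exact absurd (h1' ⟨hx, h1.2.1.trans hx1.le, h⟩) (not_le.2 hx1)
  · exact absurd (h2' ⟨hx, h, hx2.le.trans h2.2.2⟩) (not_le.2 hx2)

lemma exists_strip (hV : IsLineFibration V) (hF : IsFrame u e n) {a b c : ℝ}
    (hac : a ≤ c) (hcb : c ≤ b) (ha : Vert V u (p + a • e)) (hb : Vert V u (p + b • e))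
    (hc : ¬ Vert V u (p + c • e)) :
    ∃ x₁ x₂, a ≤ x₁ ∧ x₂ ≤ b ∧ IsStrip V u e n (p + x₁ • e) (x₂ - x₁) := by
  have hcl : IsClosed {x : ℝ | Vert V u (p + x • e)} := by
    rw [← isOpen_compl_iff]
    exact (isOpen_not_vert hV u).preimage (f := fun x : ℝ => p + x • e) (by fun_prop)
  obtain ⟨x₁, h1, x₂, h2, h3, h4, h5, h6⟩ := exists_gap hcl ha hb hc hac hcb
  refine ⟨x₁, x₂, h3, h5, hF, sub_pos.2 h4, h1, ?_, fun x hx0 hx1 => ?_⟩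
  · have : p + x₁ • e + (x₂ - x₁) • e = p + x₂ • e := by module
    rw [this]; exact h2
  · have : p + x₁ • e + x • e = p + (x₁ + x) • e := by module
    rw [this]; exact h6 _ (by linarith) (by linarith)

/-- On vertical points the continuous function `⟪V y, u⟫` takes only the values `1` and `-1`. -/
lemma eq_of_isPreconnected_of_vert (hV : IsLineFibration V) (uu : ⟪u, u⟫ = 1) {s : Set E3}
    (hs : IsPreconnected s) (h : ∀ y ∈ s, Vert V u y) {a b : E3} (ha : a ∈ s) (hb : b ∈ s) :
    V a = V b := by
  have key : ∀ a ∈ s, ∀ b ∈ s, (V a : E3) = u → (V b : E3) ≠ -u := by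
    intro a ha b hb h1 h2
    have h3 := hs.intermediate_value hb ha (hV.continuous_inner u).continuousOn
    rw [h1, h2] at h3
    obtain ⟨y, hy, hy0⟩ := h3 (show (0 : ℝ) ∈ _ by simp)
    rcases h y hy with h4 | h4 <;> simp only [h4, inner_neg_left, uu] at hy0 <;> norm_num at hy0
  apply Subtype.ext
  rcases h a ha with h1 | h1 <;> rcases h b hb with h2 | h2
  · rw [h1, h2]
  · exact absurd h2 (key a ha b hb h1)
  · exact absurd h1 (key b hb a ha h2)
  · rw [h1, h2]

lemma eq_of_vert_segment (hV : IsLineFibration V) (uu : ⟪u, u⟫ = 1) {a b : ℝ} (hab : a ≤ b)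
    (h : ∀ x, a ≤ x → x ≤ b → Vert V u (p + x • e)) : V (p + a • e) = V (p + b • e) := by
  refine eq_of_isPreconnected_of_vert hV uu
    (s := (fun x : ℝ => p + x • e) '' Set.Icc a b) ?_ ?_ ⟨a, ⟨le_rfl, hab⟩, rfl⟩
    ⟨b, ⟨hab, le_rfl⟩, rfl⟩
  · exact isPreconnected_Icc.image _ (by fun_prop)
  · rintro _ ⟨x, hx, rfl⟩
    exact h x hx.1 hx.2

/-! ### Monotonicity of slopes along vertical lines -/

lemma Vert.symm {y p : E3} (h : Vert V (V y : E3) p) : Vert V (V p : E3) y := by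
  rcases h with h | h
  · left; exact h.symm
  · right; rw [h, neg_neg]

/-- Between two parallel fibers in a plane which also is parallel to a fiber of another direction,
all fibers are parallel. -/
lemma vert_of_between (hV : IsLineFibration V) (hP : ¬ IsPlanar V) (hF : IsFrame u e n)
    (hp : Vert V u p) {y : E3} (hy : ¬ Vert V u y) {ζ z : ℝ} (h0 : 0 ≤ z) (h1 : z ≤ ζ)
    (h : Vert V (V y) (y + ζ • u)) : Vert V (V y) (y + z • u) := by
  set v : E3 := (V y : E3) with hv
  have vv : ⟪v, v⟫ = 1 := inner_self_coe _
  -- The part of `u` orthogonal to `v`: the vertical line through `y` lies in the plane through `y`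
  -- spanned by `v` and `d`, where a gap would be a strip for `v`.
  set d : E3 := u - ⟪u, v⟫ • v with hd
  have hpv : ¬ Vert V v p := by
    intro h
    apply hy
    have := h.symm
    unfold Vert at this ⊢
    rcases hp with hp | hp <;> rw [hp] at this
    · exact this
    · rwa [neg_neg, or_comm] at this
  have hd0 : d ≠ 0 := by
    intro hd0
    have h2 : u = ⟪u, v⟫ • v := sub_eq_zero.1 hd0
    have h3 : ⟪u, v⟫ = 1 ∨ ⟪u, v⟫ = -1 := by
      rw [← sq_eq_one_iff]
      have h4 := hF.uu
      rw [h2, real_inner_smul_left, real_inner_smul_right, vv] at h4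
      linarith
    apply hy
    unfold Vert
    rcases h3 with h3 | h3 <;> rw [h3] at h2
    · left; rw [h2, one_smul]
    · right; rw [h2]; simp [hv]
  have vd : ⟪v, d⟫ = 0 := by
    rw [hd, inner_sub_right, real_inner_smul_right, vv, real_inner_comm]; ring
  obtain ⟨e', n', hF', hde⟩ := exists_frame_of_orthogonal vv hd0 vd
  set k := ‖d‖ with hk
  have hk0 : 0 ≤ k := norm_nonneg d
  have hu : u = k • e' + ⟪u, v⟫ • v := by rw [← hde, hd]; module
  have hshift : ∀ z : ℝ, y + z • u = y + (z * k) • e' + (z * ⟪u, v⟫) • v := by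
    intro z
    nth_rw 1 [hu]
    module
  rw [hshift, vert_add_smul_iff hV] at h ⊢
  by_contra hz
  have hyv : Vert V v (y + (0 : ℝ) • e') := by rw [zero_smul, add_zero]; left; rfl
  obtain ⟨x₁, x₂, -, -, hS⟩ := exists_strip hV hF' (by positivity)
    (mul_le_mul_of_nonneg_right h1 hk0) hyv h hz
  -- The fiber through `p` is not parallel to `v`, so it would have to cross the strip
  -- transversally; yet it is parallel to `u`, which lies in the plane of the strip.
  apply (hS.mem_swept_of_not_vert hV hP hpv).1
  have hun : ⟪u, n'⟫ = 0 := by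
    rw [hu, inner_add_left, real_inner_smul_left, real_inner_smul_left, hF'.en, hF'.un]; ring
  rcases hp with hp | hp <;> simp [hp, hun]

lemma slope_eq_of_vert {y y' : E3} (h : Vert V (V y) y') : slope V e n y' = slope V e n y := by
  unfold slope
  rcases h with h | h <;> simp [h]

/-- Equal slopes put the second direction into the span of `V y` and `u`. The base points differ by
a multiple of `u`, so the two fibers are coplanar, hence parallel. -/
lemma vert_of_slope_eq (hV : IsLineFibration V) (hF : IsFrame u e n) {y : E3} {ζ : ℝ}
    (hy : ⟪(V y : E3), n⟫ ≠ 0) (hy' : ⟪(V (y + ζ • u) : E3), n⟫ ≠ 0)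
    (h : slope V e n (y + ζ • u) = slope V e n y) : Vert V (V y) (y + ζ • u) := by
  set y' := y + ζ • u with hy'y
  set c := ⟪(V y' : E3), n⟫ / ⟪(V y : E3), n⟫ with hc
  set μ := ⟪(V y' : E3), u⟫ - c * ⟪(V y : E3), u⟫ with hμ
  have key : (V y' : E3) = c • (V y : E3) + μ • u := by
    unfold slope at h
    apply hF.ext <;>
      simp only [inner_add_left, real_inner_smul_left, hF.uu, hF.ue, hF.un, hμ]
    · ring
    · rw [div_eq_div_iff hy' hy] at h
      rw [hc]
      field_simp
      linear_combination h
    · rw [hc]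
      field_simp
      ring
  by_cases hμ0 : μ = 0
  · rw [hμ0, zero_smul, add_zero] at key
    have h1 := inner_self_coe (V y')
    rw [key, real_inner_smul_left, real_inner_smul_right, inner_self_coe] at h1
    have h3 : c = 1 ∨ c = -1 := by
      rw [← sq_eq_one_iff]
      linarith
    unfold Vert
    rcases h3 with h3 | h3 <;> rw [key, h3]
    · left; rw [one_smul]
    · right; rw [neg_one_smul]
  · left
    rw [hV.eq_of_sub_eq (p := y) (q := y') (a := -(ζ / μ * c)) (b := ζ / μ)]
    rw [key, hy'y]
    match_scalars <;> field_simp <;> ring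

/-- If `f c` lay outside the interval between `f a` and `f b`, the intermediate value theorem would
repeat one of these end values on the other side of `c`, and the hypothesis would force `f c` to
equal it. -/
lemma monotone_or_antitone_of_eq_between {f : ℝ → ℝ} (hf : Continuous f)
    (h : ∀ a b, f a = f b → ∀ c, a ≤ c → c ≤ b → f c = f a) : Monotone f ∨ Antitone f := by
  have key : ∀ f : ℝ → ℝ, Continuous f → (∀ a b, f a = f b → ∀ c, a ≤ c → c ≤ b → f c = f a) →
      ∀ a b c, a ≤ c → c ≤ b → f c ≤ max (f a) (f b) := by
    intro f hf h a b c hac hcb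
    by_contra! hlt
    rw [max_lt_iff] at hlt
    rcases le_total (f a) (f b) with hab | hab
    · obtain ⟨x, hx, hxb⟩ := intermediate_value_Icc hac hf.continuousOn
        (show f b ∈ Set.Icc (f a) (f c) from ⟨hab, hlt.2.le⟩)
      have := h x b hxb c hx.2 hcb
      linarith [hlt.2]
    · obtain ⟨x, hx, hxb⟩ := intermediate_value_Icc' hcb hf.continuousOn
        (show f a ∈ Set.Icc (f b) (f c) from ⟨hab, hlt.1.le⟩)
      have := h a x hxb.symm c hac hx.1
      linarith [hlt.1]
  rw [Set.monotone_or_antitone_iff_uIcc]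
  have key2 : ∀ a b c, a ≤ c → c ≤ b → f c ∈ Set.uIcc (f a) (f b) := by
    intro a b c hac hcb
    refine ⟨?_, key f hf h a b c hac hcb⟩
    have := key (fun x => -f x) hf.neg
      (fun a b hab c h1 h2 => by rw [h a b (neg_injective hab) c h1 h2]) a b c hac hcb
    rw [max_neg_neg] at this
    exact neg_le_neg_iff.1 this
  intro a b c hc
  rcases le_total a b with hab | hab
  · rw [Set.uIcc_of_le hab] at hc
    exact key2 a b c hc.1 hc.2
  · rw [Set.uIcc_of_ge hab] at hc
    rw [Set.uIcc_comm]
    exact key2 b a c hc.1 hc.2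

namespace IsStrip

lemma neg_normal (hS : IsStrip V u e n p ℓ) : IsStrip V u e (-n) p ℓ :=
  ⟨hS.frame.neg_right, hS.pos, hS.left, hS.right, hS.mid⟩

lemma reverse (hS : IsStrip V u e n p ℓ) : IsStrip V u (-e) n (p + ℓ • e) ℓ := by
  refine ⟨hS.frame.neg_mid, hS.pos, hS.right, ?_, fun x h0 h1 => ?_⟩
  · have : p + ℓ • e + ℓ • -e = p := by module
    rw [this]; exact hS.left
  · have : p + ℓ • e + x • -e = p + (ℓ - x) • e := by module
    rw [this]; exact hS.mid _ (by linarith) (by linarith)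

lemma monotone_or_antitone_slope (hV : IsLineFibration V) (hS : IsStrip V u e n p ℓ)
    (hP : ¬ IsPlanar V) {y : E3} (hy : ¬ Vert V u y) :
    Monotone (fun z : ℝ => slope V e n (y + z • u)) ∨
      Antitone (fun z : ℝ => slope V e n (y + z • u)) := by
  have hnv : ∀ z : ℝ, ¬ Vert V u (y + z • u) := fun z => (vert_add_smul_iff hV z).not.2 hy
  have hn : ∀ z : ℝ, ⟪(V (y + z • u) : E3), n⟫ ≠ 0 := fun z =>
    (hS.mem_swept_of_not_vert hV hP (hnv z)).1
  apply monotone_or_antitone_of_eq_between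
  · rw [continuous_iff_continuousAt]
    intro z
    exact ContinuousAt.comp (f := fun z : ℝ => y + z • u) (continuousAt_slope hV (hn z))
      (by fun_prop)
  · intro a b hab c hac hcb
    have hsh : ∀ x : ℝ, y + x • u = y + a • u + (x - a) • u := fun x => by module
    have hb := hn b
    rw [hsh b] at hab hb
    have h1 := vert_of_slope_eq hV hS.frame (hn a) hb hab.symm
    have h2 := vert_of_between hV hP hS.frame hS.left (hnv a) (sub_nonneg.2 hac)
      (sub_le_sub_right hcb a) h1
    rw [hsh c]
    exact slope_eq_of_vert h2

/-- With constant slope, every fiber through the vertical line is parallel to `V y`. These fibers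
fill the plane spanned by `u` and `V y`, which makes the fibration planar. -/
lemma exists_slope_ne (hV : IsLineFibration V) (hS : IsStrip V u e n p ℓ)
    (hP : ¬ IsPlanar V) {y : E3} (hy : ¬ Vert V u y) :
    ∃ z : ℝ, slope V e n (y + z • u) ≠ slope V e n y := by
  by_contra! h
  have hF := hS.frame
  have hnv : ∀ z : ℝ, ¬ Vert V u (y + z • u) := fun z => (vert_add_smul_iff hV z).not.2 hy
  have hn : ∀ z : ℝ, ⟪(V (y + z • u) : E3), n⟫ ≠ 0 := fun z =>
    (hS.mem_swept_of_not_vert hV hP (hnv z)).1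
  have hn0 : ⟪(V y : E3), n⟫ ≠ 0 := (hS.mem_swept_of_not_vert hV hP hy).1
  have hpar : ∀ z : ℝ, Vert V (V y) (y + z • u) := fun z =>
    vert_of_slope_eq hV hF hn0 (hn z) (h z)
  apply hP
  set α := ⟪(V y : E3), e⟫ with hα
  set β := ⟪(V y : E3), n⟫ with hβ
  have hinner : ∀ w : E3, ⟪w, β • e - α • n⟫ = β * ⟪w, e⟫ - α * ⟪w, n⟫ := fun w => by
    rw [inner_sub_right, real_inner_smul_right, real_inner_smul_right]
  refine hV.isPlanar_of_plane (n := β • e - α • n) ?_ y fun w hw => ?_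
  · intro h0
    have h1 := hinner e
    rw [h0, hF.ee, hF.en] at h1
    simp at h1
    exact hn0 h1.symm
  · rw [hinner] at hw
    set t := ⟪w - y, n⟫ / β with ht
    have hw' : w = y + (⟪w - y, u⟫ - t * ⟪(V y : E3), u⟫) • u + t • (V y : E3) := by
      rw [add_assoc, ← sub_eq_iff_eq_add']
      apply hF.ext <;>
        simp only [inner_add_left, real_inner_smul_left, hF.uu, hF.ue, hF.un, ← hα, ← hβ, ht]
      · ring
      · field_simp
        linear_combination hw
      · field_simp
        ring
    have hp' := (vert_add_smul_iff hV t).2 (hpar (⟪w - y, u⟫ - t * ⟪(V y : E3), u⟫))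
    rw [← hw'] at hp'
    have hz : ⟪(V y : E3), β • e - α • n⟫ = 0 := by rw [hinner]; ring
    rcases hp' with h1 | h1 <;> rw [h1]
    · exact hz
    · rw [inner_neg_left, hz, neg_zero]

/-- Non-vertical points are reached by starting in the open strip and flowing along fibers, so they
form a continuous image of a product of intervals. -/
lemma isPreconnected_not_vert (hV : IsLineFibration V) (hS : IsStrip V u e n p ℓ)
    (hP : ¬ IsPlanar V) : IsPreconnected {y | ¬ Vert V u y} := by
  let f : ℝ × ℝ × ℝ → E3 := fun a =>
    (p + a.1 • e + a.2.1 • u) + a.2.2 • (V (p + a.1 • e + a.2.1 • u) : E3)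
  have hf : Continuous f := by
    have h1 : Continuous fun a : ℝ × ℝ × ℝ => p + a.1 • e + a.2.1 • u := by fun_prop
    exact h1.add ((continuous_snd.comp continuous_snd).smul (hV.continuous_coe.comp h1))
  have h2 : {y | ¬ Vert V u y} = f '' (Set.Ioo 0 ℓ ×ˢ Set.univ ×ˢ Set.univ) := by
    ext y
    constructor
    · intro hy
      have hW := hS.mem_swept_of_not_vert hV hP hy
      obtain ⟨t, z, h⟩ := exists_foot hS.frame p hW.1
      refine ⟨(crossing V e n p y, z, -t), ⟨⟨hW.2.1, hW.2.2⟩, trivial, trivial⟩, ?_⟩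
      simp only [f]
      rw [← h, hV.integral]
      module
    · rintro ⟨⟨x, z, t⟩, ⟨hx, -⟩, rfl⟩
      exact hS.not_vert_of_mem_swept (swept_fiber hV (hS.mem_swept hV hx.1 hx.2 z) t)
  rw [h2]
  exact (isPreconnected_Ioo.prod (isPreconnected_univ.prod isPreconnected_univ)).image _
    hf.continuousOn

/-- The slopes along vertical lines are all monotone, or all antitone. -/
lemma forall_monotone_or_forall_antitone (hV : IsLineFibration V) (hS : IsStrip V u e n p ℓ)
    (hP : ¬ IsPlanar V) :
    (∀ y, ¬ Vert V u y → Monotone (fun z : ℝ => slope V e n (y + z • u))) ∨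
      (∀ y, ¬ Vert V u y → Antitone (fun z : ℝ => slope V e n (y + z • u))) := by
  have hcont : ∀ y, ¬ Vert V u y → ∀ z : ℝ,
      ContinuousAt (fun y => slope V e n (y + z • u)) y := fun y hy z => by
    have h1 : ⟪(V (y + z • u) : E3), n⟫ ≠ 0 :=
      (hS.mem_swept_of_not_vert hV hP ((vert_add_smul_iff hV z).not.2 hy)).1
    exact ContinuousAt.comp (f := fun y : E3 => y + z • u) (continuousAt_slope hV h1)
      (by fun_prop)
  -- Somewhere a strict increase, respectively a strict decrease: two open conditions, mutually
  -- exclusive by monotonicity, and one of them always holds because slopes are not constant.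
  let A : Set E3 := {y | ¬ Vert V u y ∧ ∃ a b : ℝ, a < b ∧
    slope V e n (y + a • u) < slope V e n (y + b • u)}
  let B : Set E3 := {y | ¬ Vert V u y ∧ ∃ a b : ℝ, a < b ∧
    slope V e n (y + b • u) < slope V e n (y + a • u)}
  have hA : IsOpen A := by
    rw [isOpen_iff_mem_nhds]
    rintro y ⟨hy, a, b, hab, h⟩
    filter_upwards [(isOpen_not_vert hV u).mem_nhds hy,
      (hcont y hy a).eventually_lt (hcont y hy b) h] with w hw hw'
    exact ⟨hw, a, b, hab, hw'⟩
  have hB : IsOpen B := by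
    rw [isOpen_iff_mem_nhds]
    rintro y ⟨hy, a, b, hab, h⟩
    filter_upwards [(isOpen_not_vert hV u).mem_nhds hy,
      (hcont y hy b).eventually_lt (hcont y hy a) h] with w hw hw'
    exact ⟨hw, a, b, hab, hw'⟩
  have hdisj : Disjoint A B := by
    rw [Set.disjoint_left]
    rintro y ⟨hy, a, b, hab, h⟩ ⟨-, a', b', hab', h'⟩
    rcases hS.monotone_or_antitone_slope hV hP hy with hm | hm
    · exact absurd (hm hab'.le) (not_le.2 h')
    · exact absurd (hm hab.le) (not_le.2 h)
  have hcover : {y | ¬ Vert V u y} ⊆ A ∪ B := by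
    intro y hy
    obtain ⟨z, hz⟩ := hS.exists_slope_ne hV hP hy
    have h0 : slope V e n y = slope V e n (y + (0 : ℝ) • u) := by rw [zero_smul, add_zero]
    rw [h0] at hz
    have hz0 : z ≠ 0 := by rintro rfl; exact hz rfl
    rcases lt_or_gt_of_ne hz with h | h <;> rcases lt_or_gt_of_ne hz0 with h' | h'
    · exact Or.inl ⟨hy, _, _, h', h⟩
    · exact Or.inr ⟨hy, _, _, h', h⟩
    · exact Or.inr ⟨hy, _, _, h', h⟩
    · exact Or.inl ⟨hy, _, _, h', h⟩
  rcases (hS.isPreconnected_not_vert hV hP).subset_or_subset hA hB hdisj hcover with h | h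
  · left
    intro y hy
    rcases hS.monotone_or_antitone_slope hV hP hy with hm | hm
    · exact hm
    · obtain ⟨-, a, b, hab, h'⟩ := h hy
      exact absurd (hm hab.le) (not_le.2 h')
  · right
    intro y hy
    rcases hS.monotone_or_antitone_slope hV hP hy with hm | hm
    · obtain ⟨-, a, b, hab, h'⟩ := h hy
      exact absurd (hm hab.le) (not_le.2 h')
    · exact hm

end IsStrip

/-! ### The two edges of a strip cannot have the same direction -/

namespace IsStrip

/-- Fibers close to the left edge point almost along `u`. Let their horizontal parts, normalized,
accumulate at `w'`. If slopes were antitone, points near `p + s • w'` would have crossing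
coordinates at most those of the fibers near the edge, which tend to `0`. So no point of the line
through `p` along `w'` is swept, the whole line is vertical, and the fibration is planar. -/
lemma not_forall_antitone (hV : IsLineFibration V) (hS : IsStrip V u e n p ℓ)
    (hP : ¬ IsPlanar V) (hu : (V p : E3) = u)
    (hN : ∀ x, 0 < x → x < ℓ → 0 < ⟪(V (p + x • e) : E3), n⟫) :
    ¬ ∀ y, ¬ Vert V u y → Antitone (fun z : ℝ => slope V e n (y + z • u)) := by
  intro hA
  have hF := hS.frame
  have hℓ := hS.pos
  -- points of the strip approaching `p`, and the directions of their projected fibers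
  let ε : ℕ → ℝ := fun k => ℓ * (1 / ((k : ℝ) + 2))
  have hε0 : ∀ k, 0 < ε k := fun k => by positivity
  have hε1 : ∀ k, ε k < ℓ := fun k => by
    have : 1 / ((k : ℝ) + 2) < 1 := by
      rw [div_lt_one (by positivity)]
      have : (0 : ℝ) ≤ k := Nat.cast_nonneg k
      linarith
    calc ε k < ℓ * 1 := mul_lt_mul_of_pos_left this hℓ
      _ = ℓ := mul_one ℓ
  have hεlim : Tendsto ε atTop (𝓝 0) := by
    have h1 : Tendsto (fun k : ℕ => 1 / ((k : ℝ) + 2)) atTop (𝓝 0) := by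
      have := (tendsto_one_div_add_atTop_nhds_zero_nat (𝕜 := ℝ)).comp (tendsto_add_atTop_nat 1)
      refine this.congr fun k => ?_
      simp only [Function.comp_apply, Nat.cast_add, Nat.cast_one]
      ring
    simpa [ε] using h1.const_mul ℓ
  let y : ℕ → E3 := fun k => p + ε k • e
  have hylim : Tendsto y atTop (𝓝 p) := by
    simpa using tendsto_const_nhds.add (hεlim.smul_const e)
  let d : ℕ → E3 := fun k => (V (y k) : E3) - ⟪(V (y k) : E3), u⟫ • u
  have hdn : ∀ k, ⟪d k, n⟫ = ⟪(V (y k) : E3), n⟫ := fun k => by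
    simp only [d, inner_sub_left, real_inner_smul_left, hF.un]; ring
  have hdu : ∀ k, ⟪d k, u⟫ = 0 := fun k => by
    simp only [d, inner_sub_left, real_inner_smul_left, hF.uu]; ring
  have hd0 : ∀ k, d k ≠ 0 := fun k h => by
    have h1 := hdn k
    rw [h, inner_zero_left] at h1
    exact (hN _ (hε0 k) (hε1 k)).ne h1
  have hρ : ∀ k, 0 < ‖d k‖ := fun k => norm_pos_iff.2 (hd0 k)
  let w : ℕ → E3 := fun k => ‖d k‖⁻¹ • d k
  have hw1 : ∀ k, w k ∈ Metric.sphere (0 : E3) 1 := fun k => by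
    simp [w, norm_smul, (hρ k).ne']
  obtain ⟨w', hw', φ, hφ, hlim⟩ := (isCompact_sphere (0 : E3) 1).tendsto_subseq hw1
  have hw'u : ⟪u, w'⟫ = 0 := by
    have h1 : Tendsto (fun k => ⟪u, w (φ k)⟫) atTop (𝓝 ⟪u, w'⟫) := tendsto_const_nhds.inner hlim
    refine tendsto_nhds_unique h1 (tendsto_const_nhds.congr fun k => ?_)
    rw [real_inner_comm]
    simp only [w, real_inner_smul_left, hdu, mul_zero]
  have hw'w' : ⟪w', w'⟫ = 1 := inner_self_coe ⟨w', hw'⟩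
  obtain ⟨n', hF'⟩ := exists_frame hF.uu hw'w' hw'u
  apply hP
  refine isPlanar_of_line hV hF' p fun s => ?_
  by_contra hs
  have hsw := hS.mem_swept_of_not_vert hV hP hs
  let Y : ℕ → E3 := fun k => y (φ k) + s • w (φ k)
  have hYlim : Tendsto Y atTop (𝓝 (p + s • w')) :=
    (hylim.comp hφ.tendsto_atTop).add (hlim.const_smul s)
  have hcross := ((continuousAt_crossing (e := e) (p := p) hV hsw.1).tendsto).comp hYlim
  have hup : ∀ᶠ k in atTop, 0 < ⟪(V (y (φ k)) : E3), u⟫ := by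
    have h1 : Tendsto (fun k => ⟪(V (y (φ k)) : E3), u⟫) atTop (𝓝 ⟪(V p : E3), u⟫) :=
      ((hV.continuous_inner u).tendsto p).comp (hylim.comp hφ.tendsto_atTop)
    rw [hu, hF.uu] at h1
    exact h1.eventually (lt_mem_nhds one_pos)
  have hle : ∀ᶠ k in atTop, crossing V e n p (Y k) ≤ ε (φ k) := by
    filter_upwards [hup, hYlim.eventually ((isOpen_not_vert hV u).mem_nhds hs)] with k hk hYk
    have hn0 := hN _ (hε0 (φ k)) (hε1 (φ k))
    have hρk := hρ (φ k)
    set v : E3 := (V (y (φ k)) : E3) with hv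
    set r := s / ‖d (φ k)‖ with hr
    set z := r * ⟪v, u⟫ with hz
    -- The point on the fiber of `y (φ k)` lying on the same vertical line as `Y k`; `r` is chosen
    -- so that its horizontal displacement is `s • w (φ k)`.
    have h1 : Y k + z • u = y (φ k) + r • v := by
      have hdk : d (φ k) = v - ⟪v, u⟫ • u := rfl
      have hwk : s • w (φ k) = r • d (φ k) := by
        simp only [w, smul_smul, hr, div_eq_mul_inv]
      simp only [Y]
      rw [hwk, hdk, hz]
      module
    have h2 : slope V e n (Y k + z • u) = slope V e n (y (φ k)) := by
      rw [h1, slope_fiber hV]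
    have h3 : crossing V e n p (Y k + z • u) = ε (φ k) := by
      rw [h1, crossing_fiber hV hn0.ne']
      have := crossing_strip (V := V) (p := p) hF (ε (φ k)) 0
      rwa [zero_smul, add_zero] at this
    have ht : ⟪Y k - p, n⟫ = r * ⟪v, n⟫ := by
      have : Y k = y (φ k) + r • v - z • u := eq_sub_of_add_eq h1
      rw [this]
      simp only [y, inner_add_left, inner_sub_left, real_inner_smul_left, hF.un, hF.en]
      ring
    have h4 : crossing V e n p (Y k) = ε (φ k)
        + r * ⟪v, n⟫ * (slope V e n (Y k + z • u) - slope V e n (Y k)) := by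
      rw [← h3, ← ht]
      unfold crossing
      simp only [inner_add_left, inner_sub_left, real_inner_smul_left, hF.un, hF.ue]
      ring
    rw [h4]
    have hmono := hA (Y k) hYk
    -- Eventually `⟪v, u⟫ > 0`, so the height `z` has the sign of `r`, and antitonicity makes the
    -- correction term nonpositive for either sign.
    rcases le_total 0 s with h0 | h0
    · have hr0 : 0 ≤ r := div_nonneg h0 hρk.le
      have h5 := hmono (show (0 : ℝ) ≤ z from mul_nonneg hr0 hk.le)
      simp only [zero_smul, add_zero] at h5
      have := mul_nonneg (mul_nonneg hr0 hn0.le) (sub_nonneg.2 h5)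
      linarith
    · have hr0 : r ≤ 0 := div_nonpos_of_nonpos_of_nonneg h0 hρk.le
      have h5 := hmono (show z ≤ 0 from mul_nonpos_of_nonpos_of_nonneg hr0 hk.le)
      simp only [zero_smul, add_zero] at h5
      have := mul_nonneg (mul_nonneg (neg_nonneg.2 hr0) hn0.le) (sub_nonneg.2 h5)
      linarith
  have := le_of_tendsto_of_tendsto hcross (hεlim.comp hφ.tendsto_atTop) hle
  exact absurd hsw.2.1 (not_lt.2 this)

/-- A strip whose two edges are fibers of the same direction only exists in planar fibrations. -/
lemma isPlanar_of_eq (hV : IsLineFibration V) (hS : IsStrip V u e n p ℓ)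
    (h0 : (V p : E3) = u) (h1 : (V (p + ℓ • e) : E3) = u) : IsPlanar V := by
  by_contra hP
  -- The `n`-component does not vanish on the open strip, so it has constant sign there; reversing
  -- `n` makes it positive.
  wlog hN : ∀ x, 0 < x → x < ℓ → 0 < ⟪(V (p + x • e) : E3), n⟫ generalizing n
  · apply this hS.neg_normal
    intro x hx0 hx1
    have hne : ∀ x, 0 < x → x < ℓ → ⟪(V (p + x • e) : E3), n⟫ ≠ 0 := fun x hx0 hx1 => by
      have := hS.inner_ne_zero hV hx0 hx1 0
      rwa [zero_smul, add_zero] at this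
    rw [inner_neg_right, neg_pos]
    by_contra! hx
    apply hN
    intro x' hx0' hx1'
    by_contra! hx'
    have hc : ContinuousOn (fun x : ℝ => ⟪(V (p + x • e) : E3), n⟫) (Set.Ioo 0 ℓ) :=
      ((hV.continuous_inner n).comp (by fun_prop : Continuous fun x : ℝ => p + x • e)).continuousOn
    obtain ⟨x'', ⟨ha, hb⟩, hc⟩ := isPreconnected_Ioo.intermediate_value
      ⟨hx0', hx1'⟩ ⟨hx0, hx1⟩ hc ⟨hx', hx⟩
    exact hne x'' ha hb hc
  rcases hS.forall_monotone_or_forall_antitone hV hP with h | h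
  -- Seen from the right edge, `e` is replaced by `-e` and slopes change sign, while `n` and the
  -- common direction `u` are kept; monotone becomes antitone.
  · refine hS.reverse.not_forall_antitone hV hP h1 (fun x hx0 hx1 => ?_) fun y hy => ?_
    · have : p + ℓ • e + x • -e = p + (ℓ - x) • e := by module
      rw [this]
      exact hN _ (by linarith) (by linarith)
    · have h2 : ∀ w, slope V (-e) n w = -slope V e n w := fun w => by
        unfold slope
        rw [inner_neg_right, neg_div]
      simp only [h2]
      exact (h y hy).neg
  · exact hS.not_forall_antitone hV hP h0 hN h

end IsStrip

/-! ### Convexity of base spaces and exclusion of antipodal directions -/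

lemma mem_baseSpace {u : S2} {y : E3} :
    y ∈ baseSpace V u ↔ ⟪(u : E3), y⟫ = 0 ∧ V y = u := by
  unfold baseSpace
  rw [Set.mem_inter_iff, SetLike.mem_coe, Submodule.mem_orthogonal_singleton_iff_inner_right]
  rfl

/-- Base spaces of fibrations which are not planar contain the segments between their points. -/
lemma add_smul_sub_mem_baseSpace (hV : IsLineFibration V) (hP : ¬ IsPlanar V) {u : S2} {p q : E3}
    (hp : p ∈ baseSpace V u) (hq : q ∈ baseSpace V u) {c : ℝ} (h0 : 0 ≤ c) (h1 : c ≤ 1) :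
    p + c • (q - p) ∈ baseSpace V u := by
  rw [mem_baseSpace] at *
  have ho : ⟪(u : E3), q - p⟫ = 0 := by rw [inner_sub_right, hp.1, hq.1, sub_zero]
  refine ⟨by rw [inner_add_right, real_inner_smul_right, hp.1, ho]; ring, ?_⟩
  by_cases hd : q - p = 0
  · rw [hd, smul_zero, add_zero]; exact hp.2
  obtain ⟨e, n, hF, hde⟩ := exists_frame_of_orthogonal (inner_self_coe u) hd ho
  set L := ‖q - p‖ with hL
  have hL0 : 0 ≤ L := norm_nonneg _
  have hpe : p + (0 : ℝ) • e = p := by module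
  have hqe : p + L • e = q := by rw [← hde]; abel
  rw [hde, smul_smul]
  have hc0 : 0 ≤ c * L := by positivity
  have hc1 : c * L ≤ L := mul_le_of_le_one_left hL0 h1
  have hvp : Vert V u (p + (0 : ℝ) • e) := by rw [hpe]; left; rw [hp.2]
  have hvq : Vert V u (p + L • e) := by rw [hqe]; left; rw [hq.2]
  by_cases hall : ∀ x, 0 ≤ x → x ≤ L → Vert V u (p + x • e)
  · rw [← eq_of_vert_segment hV hF.uu hc0 fun x hx0 hx1 => hall x hx0 (hx1.trans hc1), hpe]
    exact hp.2
  · push Not at hall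
    obtain ⟨x, hx0, hx1, hx⟩ := hall
    -- Outside this strip the line is vertical, so orientation is constant from `p` to one edge and
    -- from `q` to the other: both edges have direction `u`.
    obtain ⟨x₁, x₂, h3, h4, hS⟩ := exists_strip hV hF hx0 hx1 hvp hvq hx
    exfalso
    apply hP
    apply hS.isPlanar_of_eq hV
    · rw [← eq_of_vert_segment hV hF.uu h3, hpe, hp.2]
      intro y hy0 hy1
      have := hS.vert_of_coplanar hV hP (x := y - x₁) (Or.inl (by linarith))
      have h5 : p + x₁ • e + (y - x₁) • e = p + y • e := by module
      rwa [h5] at this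
    · have h5 : p + x₁ • e + (x₂ - x₁) • e = p + x₂ • e := by module
      rw [h5, eq_of_vert_segment hV hF.uu h4, hqe, hq.2]
      intro y hy0 hy1
      have := hS.vert_of_coplanar hV hP (x := y - x₁) (Or.inr (by linarith))
      have h5 : p + x₁ • e + (y - x₁) • e = p + y • e := by module
      rwa [h5] at this

lemma convex_baseSpace (hV : IsLineFibration V) (hP : ¬ IsPlanar V) (u : S2) :
    Convex ℝ (baseSpace V u) := by
  rw [convex_iff_forall_pos]
  intro p hp q hq a b ha hb hab
  have h := add_smul_sub_mem_baseSpace hV hP hp hq hb.le (by linarith)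
  have h1 : a • p + b • q = p + b • (q - p) := by
    rw [eq_sub_of_add_eq hab]; module
  rwa [h1]

lemma exists_mem_baseSpace (hV : IsLineFibration V) (y : E3) :
    ∃ t : ℝ, y + t • (V y : E3) ∈ baseSpace V (V y) := by
  refine ⟨-⟪(V y : E3), y⟫, ?_⟩
  rw [mem_baseSpace, hV.integral, inner_add_right, real_inner_smul_right, inner_self_coe]
  exact ⟨by ring, rfl⟩

lemma baseSpace_nonempty (hV : IsLineFibration V) {u : S2} (hu : u ∈ directions V) :
    (baseSpace V u).Nonempty := by
  obtain ⟨y, rfl⟩ := hu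
  obtain ⟨t, ht⟩ := exists_mem_baseSpace hV y
  exact ⟨_, ht⟩

lemma isClosed_baseSpace (hV : IsLineFibration V) (u : S2) : IsClosed (baseSpace V u) :=
  (Submodule.isClosed_orthogonal _).inter (isClosed_singleton.preimage hV.continuous)

lemma not_isCompact_of_ray {S : Set E3} {p e : E3} (he : e ≠ 0)
    (h : ∀ x : ℝ, 0 ≤ x → p + x • e ∈ S) : ¬ IsCompact S := by
  intro hS
  obtain ⟨M, hM⟩ := hS.isBounded.exists_norm_le
  have he' := norm_pos_iff.2 he
  have hM0 : 0 ≤ M := (norm_nonneg _).trans (hM _ (h 0 le_rfl))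
  have hx : 0 ≤ (M + ‖p‖ + 1) / ‖e‖ := by positivity
  have h1 := hM _ (h _ hx)
  have h2 : ‖((M + ‖p‖ + 1) / ‖e‖) • e‖ = M + ‖p‖ + 1 := by
    rw [norm_smul, Real.norm_of_nonneg hx]
    field_simp
  have h3 := norm_sub_le (p + ((M + ‖p‖ + 1) / ‖e‖) • e) p
  rw [add_sub_cancel_left, h2] at h3
  linarith

/-- In a planar fibration each base space is a union of parallel lines. -/
lemma IsPlanar.exists_line (hV : IsLineFibration V) (h : IsPlanar V) {u : S2}
    (hu : u ∈ directions V) : ∃ e : E3, ⟪e, e⟫ = 1 ∧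
      ∀ p ∈ baseSpace V u, ∀ x : ℝ, p + x • e ∈ baseSpace V u := by
  obtain ⟨n, hn, h⟩ := h
  obtain ⟨y, hy⟩ := hu
  have hun : ⟪(u : E3), n⟫ = 0 := by rw [← hy]; exact h y
  obtain ⟨n', e, hF, hne⟩ := exists_frame_of_orthogonal (inner_self_coe u) hn hun
  have hn' : ∀ y, ⟪(V y : E3), n'⟫ = 0 := by
    intro y
    have := h y
    rw [hne, real_inner_smul_right] at this
    exact (mul_eq_zero.1 this).resolve_left (norm_ne_zero_iff.2 hn)
  have hF' : IsFrame (u : E3) e n' := ⟨hF.uu, hF.nn, hF.ee, hF.un, hF.ue, hF.ne⟩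
  refine ⟨e, hF.nn, fun p hp x => ?_⟩
  rw [mem_baseSpace] at hp ⊢
  have hvp : Vert V u p := by left; rw [hp.2]
  -- In the plane through `p` orthogonal to `n'`, a non-vertical fiber would be transverse to that
  -- plane, while `V` is orthogonal to `n'`.
  have hvert : ∀ x : ℝ, Vert V u (p + x • e) := by
    intro x
    by_contra hx
    refine inner_ne_zero_of_coplanar hV hF' hvp hx ?_ (hn' _)
    simp [real_inner_smul_left, hF'.en]
  refine ⟨by rw [inner_add_right, real_inner_smul_right, hp.1, hF'.ue]; ring, ?_⟩
  rw [← hp.2]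
  have hp0 : p + (0 : ℝ) • e = p := by module
  nth_rw 2 [← hp0]
  rcases le_total 0 x with hx | hx
  · exact (eq_of_vert_segment hV hF.uu hx fun x _ _ => hvert x).symm
  · exact eq_of_vert_segment hV hF.uu hx fun x _ _ => hvert x

lemma IsPlanar.not_isCompact (hV : IsLineFibration V) (h : IsPlanar V) {u : S2}
    (hu : u ∈ directions V) : ¬ IsCompact (baseSpace V u) := by
  obtain ⟨e, he, h⟩ := h.exists_line hV hu
  obtain ⟨p, hp⟩ := baseSpace_nonempty hV hu
  refine not_isCompact_of_ray (p := p) (e := e) ?_ fun x _ => h p hp x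
  rintro rfl
  simp at he

/-- Fibers of directions `u` and `-u` would enclose a strip, since orientation cannot flip through
vertical fibers. Everything beyond the strip is vertical, so a ray leaving `p` away from it stays in
`S_u`. -/
lemma neg_notMem_directions (hV : IsLineFibration V) {u : S2} (hu : u ∈ directions V)
    (hc : IsCompact (baseSpace V u)) : -u ∉ directions V := by
  intro hmu
  have hP : ¬ IsPlanar V := fun h => h.not_isCompact hV hu hc
  obtain ⟨p, hp⟩ := baseSpace_nonempty hV hu
  obtain ⟨q, hq⟩ := baseSpace_nonempty hV hmu
  have hp' := mem_baseSpace.1 hp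
  have hq' := mem_baseSpace.1 hq
  have hq1 : ⟪(u : E3), q⟫ = 0 := by
    have := hq'.1
    rwa [coe_neg_sphere, inner_neg_left, neg_eq_zero] at this
  have hne : V p ≠ V q := by
    rw [hp'.2, hq'.2]
    exact ne_neg_of_mem_unit_sphere ℝ u
  have hd : q - p ≠ 0 := by
    rw [sub_ne_zero]
    rintro rfl
    exact hne rfl
  have ho : ⟪(u : E3), q - p⟫ = 0 := by rw [inner_sub_right, hp'.1, hq1, sub_zero]
  obtain ⟨e, n, hF, hde⟩ := exists_frame_of_orthogonal (inner_self_coe u) hd ho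
  set L := ‖q - p‖ with hL
  have hL0 : 0 ≤ L := norm_nonneg _
  have hpe : p + (0 : ℝ) • e = p := by module
  have hqe : p + L • e = q := by rw [← hde]; abel
  have hvp : Vert V u (p + (0 : ℝ) • e) := by rw [hpe]; left; rw [hp'.2]
  have hvq : Vert V u (p + L • e) := by rw [hqe]; right; rw [hq'.2, coe_neg_sphere]
  have hall : ¬ ∀ x, 0 ≤ x → x ≤ L → Vert V u (p + x • e) := by
    intro h
    have := eq_of_vert_segment hV hF.uu hL0 h
    rw [hpe, hqe] at this
    exact hne this
  push Not at hall
  obtain ⟨x, hx0, hx1, hx⟩ := hall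
  obtain ⟨x₁, x₂, h3, h4, hS⟩ := exists_strip hV hF hx0 hx1 hvp hvq hx
  refine not_isCompact_of_ray (p := p) (e := -e) (neg_ne_zero.2 hF.e_ne) (fun x hx => ?_) hc
  rw [mem_baseSpace]
  refine ⟨by rw [inner_add_right, real_inner_smul_right, inner_neg_right, hp'.1, hF.ue]; ring, ?_⟩
  have hx' : p + x • -e = p + (-x) • e := by module
  rw [hx', eq_of_vert_segment hV hF.uu (a := -x) (b := 0) (by linarith), hpe, hp'.2]
  intro y _ hy
  have := hS.vert_of_coplanar hV hP (x := y - x₁) (Or.inl (by linarith))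
  have h5 : p + x₁ • e + (y - x₁) • e = p + y • e := by module
  rwa [h5] at this

/-! ### Continuity at infinity -/

/-- The orthogonal projection along the unit vector `u`. -/
noncomputable def perp (u y : E3) : E3 := y - ⟪y, u⟫ • u

lemma perp_add (u y z : E3) : perp u (y + z) = perp u y + perp u z := by
  unfold perp
  rw [inner_add_left]
  module

lemma perp_smul (u y : E3) (c : ℝ) : perp u (c • y) = c • perp u y := by
  unfold perp
  rw [real_inner_smul_left]
  module

lemma perp_of_inner_eq_zero {u y : E3} (h : ⟪y, u⟫ = 0) : perp u y = y := by
  unfold perp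
  rw [h]
  module

lemma continuous_perp (u : E3) : Continuous (perp u) := by
  unfold perp
  fun_prop

lemma norm_perp_sq {u : E3} (uu : ⟪u, u⟫ = 1) (y : E3) : ‖perp u y‖ ^ 2 = ‖y‖ ^ 2 - ⟪y, u⟫ ^ 2 := by
  rw [← real_inner_self_eq_norm_sq, ← real_inner_self_eq_norm_sq]
  unfold perp
  simp only [inner_sub_left, inner_sub_right, real_inner_smul_left, real_inner_smul_right, uu]
  rw [real_inner_comm y u]
  ring

lemma norm_sub_le_of_inner_nonneg (v u : S2) (h : 0 ≤ ⟪(v : E3), (u : E3)⟫) :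
    ‖(v : E3) - u‖ ≤ 2 * ‖perp u v‖ := by
  have hv := inner_self_coe v
  have hu := inner_self_coe u
  have h1 := norm_perp_sq hu (v : E3)
  rw [← real_inner_self_eq_norm_sq (v : E3), hv] at h1
  have h2 : ‖(v : E3) - u‖ ^ 2 = 2 - 2 * ⟪(v : E3), (u : E3)⟫ := by
    rw [← real_inner_self_eq_norm_sq, inner_sub_left, inner_sub_right, inner_sub_right, hv, hu,
      real_inner_comm (v : E3)]
    ring
  refine abs_le_of_sq_le_sq' ?_ (by positivity) |>.2
  nlinarith [sq_nonneg ‖perp (u : E3) v‖]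

/-- If `S_u` is compact, the fibers through a neighborhood of `S_u` cover a double cone about
the direction `u`, up to a bounded set. -/
lemma exists_cone_bound (hV : IsLineFibration V) {u : S2} (hu : u ∈ directions V)
    (hK : IsCompact (baseSpace V u)) :
    ∃ c > 0, ∃ M, ∀ y : E3, M < c * |⟪y, (u : E3)⟫| - M →
      ‖perp u y‖ < c * |⟪y, (u : E3)⟫| - M →
      ‖(V y : E3) - u‖ * |⟪y, (u : E3)⟫| ≤ 2 * (‖perp u y‖ + M) := by
  have uu := inner_self_coe u
  set K := baseSpace V u with hKdef
  have hO : IsOpen {y | 1 / 2 < ⟪(V y : E3), (u : E3)⟫} :=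
    isOpen_lt continuous_const (hV.continuous_inner u)
  obtain ⟨δ, hδ, hsub⟩ := hK.exists_cthickening_subset_open hO (by
    intro y hy
    rw [Set.mem_ofPred_eq, (mem_baseSpace.1 hy).2, uu]
    norm_num)
  have hD : IsCompact (Metric.cthickening δ K) := hK.cthickening
  obtain ⟨M, hM⟩ := hD.isBounded.exists_norm_le
  -- The boundary shell of the neighborhood within `u^⊥`. It misses `S_u`, so fibers starting there
  -- have horizontal speed at least some `c > 0`.
  have hC : IsCompact ((Metric.cthickening δ K ∩ {r | ⟪r, (u : E3)⟫ = 0}) \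
      Metric.thickening δ K) :=
    (hD.inter_right (isClosed_eq (by fun_prop) continuous_const)).diff Metric.isOpen_thickening
  obtain ⟨c, hc, hcb⟩ := hC.exists_forall_le' (a := 0) (f := fun r => ‖perp u (V r)‖)
    ((continuous_perp u).comp hV.continuous_coe).norm.continuousOn (by
      rintro r ⟨⟨h1, h2⟩, h3⟩
      rw [norm_pos_iff]
      intro h0
      apply h3
      apply Metric.self_subset_thickening hδ
      have h4 : (1 : ℝ) / 2 < ⟪(V r : E3), (u : E3)⟫ := hsub h1
      rw [mem_baseSpace, real_inner_comm]
      refine ⟨h2, Subtype.ext ?_⟩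
      have h5 := norm_sub_le_of_inner_nonneg (V r) u (by linarith)
      rw [h0, norm_zero, mul_zero] at h5
      exact sub_eq_zero.1 (norm_le_zero_iff.1 h5))
  refine ⟨c, hc, M, fun y hM1 hy => ?_⟩
  set h := ⟪y, (u : E3)⟫ with hh
  have hy_unit : ∀ y, ‖(V y : E3)‖ = 1 := fun y => norm_eq_of_mem_sphere _
  -- the foot of a fiber on the plane orthogonal to `u`
  let G : E3 → E3 := fun y => y + (-(h / ⟪(V y : E3), (u : E3)⟫)) • (V y : E3)
  have hG : ∀ s : Set E3, (∀ y ∈ s, ⟪(V y : E3), (u : E3)⟫ ≠ 0) → ContinuousOn G s := by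
    intro s hs
    exact continuousOn_id.add (((continuousOn_const.div (hV.continuous_inner u).continuousOn
      hs).neg).smul hV.continuous_coe.continuousOn)
  have hGV : ∀ y, V (G y) = V y := fun y => hV.integral _ _
  have hfoot : ∀ y, ⟪y, (u : E3)⟫ = h → 1 / 2 ≤ ⟪(V y : E3), (u : E3)⟫ →
      ⟪G y, (u : E3)⟫ = 0 ∧ ∃ t : ℝ, |h| ≤ |t| ∧ perp u y = G y + t • perp u (V y) := by
    intro y hy hpos
    have hne : ⟪(V y : E3), (u : E3)⟫ ≠ 0 := by linarith
    have h0 : ⟪G y, (u : E3)⟫ = 0 := by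
      simp only [G, inner_add_left, real_inner_smul_left, hy]
      field_simp
      ring
    refine ⟨h0, h / ⟪(V y : E3), (u : E3)⟫, ?_, ?_⟩
    · rw [abs_div, le_div_iff₀ (abs_pos.2 hne)]
      refine mul_le_of_le_one_right (abs_nonneg h) ?_
      refine (abs_real_inner_le_norm _ _).trans ?_
      rw [hy_unit, norm_eq_of_mem_sphere, one_mul]
    · rw [← perp_of_inner_eq_zero h0, ← perp_smul, ← perp_add]
      congr 1
      simp only [G]
      module
  let O₁ : Set E3 := {y | 1 / 2 < ⟪(V y : E3), (u : E3)⟫} ∩ G ⁻¹' Metric.thickening δ K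
  let Q : Set E3 := {y | 1 / 2 ≤ ⟪(V y : E3), (u : E3)⟫} ∩ G ⁻¹' Metric.cthickening δ K
  have hO₁mem : ∀ y, y ∈ O₁ ↔ 1 / 2 < ⟪(V y : E3), (u : E3)⟫ ∧ G y ∈ Metric.thickening δ K :=
    fun y => Iff.rfl
  have hQmem : ∀ y, y ∈ Q ↔ 1 / 2 ≤ ⟪(V y : E3), (u : E3)⟫ ∧ G y ∈ Metric.cthickening δ K :=
    fun y => Iff.rfl
  have hO₁ : IsOpen O₁ := by
    refine (hG _ ?_).isOpen_inter_preimage hO Metric.isOpen_thickening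
    intro y hy
    have : (1 : ℝ) / 2 < ⟪(V y : E3), (u : E3)⟫ := hy
    linarith
  have hQ : IsClosed Q := by
    refine (hG _ ?_).preimage_isClosed_of_isClosed
      (isClosed_le continuous_const (hV.continuous_inner u)) Metric.isClosed_cthickening
    intro y hy
    have : (1 : ℝ) / 2 ≤ ⟪(V y : E3), (u : E3)⟫ := hy
    linarith
  have hO₁Q : O₁ ⊆ Q := by
    intro y hy
    rw [hO₁mem] at hy
    rw [hQmem]
    exact ⟨hy.1.le, Metric.thickening_subset_cthickening _ _ hy.2⟩
  -- The horizontal disc at height `h`. A fiber with foot in the shell has drifted at least `c *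
  -- |h|` from a foot of norm at most `M`, so it misses this disc; connectedness then puts all feet
  -- in the open neighborhood.
  let B : Set E3 := {y | ⟪y, (u : E3)⟫ = h} ∩ perp u ⁻¹' Metric.ball 0 (c * |h| - M)
  have hBmem : ∀ y, y ∈ B ↔ ⟪y, (u : E3)⟫ = h ∧ ‖perp u y‖ < c * |h| - M := fun y => by
    simp only [B, Set.mem_inter_iff, Set.mem_ofPred_eq, Set.mem_preimage, mem_ball_zero_iff]
  have hB : IsPreconnected B := by
    apply Convex.isPreconnected
    intro a ha b hb s t hs ht hst
    rw [hBmem] at ha hb ⊢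
    refine ⟨?_, ?_⟩
    · rw [inner_add_left, real_inner_smul_left, real_inner_smul_left, ha.1, hb.1, ← add_mul, hst,
        one_mul]
    · rw [perp_add, perp_smul, perp_smul]
      have h1 := convex_ball (0 : E3) (c * |h| - M) (mem_ball_zero_iff.2 ha.2)
        (mem_ball_zero_iff.2 hb.2) hs ht hst
      exact mem_ball_zero_iff.1 h1
  have hcover : B ⊆ O₁ ∪ Qᶜ := by
    intro y hy
    rw [hBmem] at hy
    obtain ⟨hy1, hy2⟩ := hy
    by_cases hyQ : y ∈ Q
    · left
      rw [hQmem] at hyQ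
      rw [hO₁mem]
      obtain ⟨h0, t, ht, hpt⟩ := hfoot y hy1 hyQ.1
      have h2 : (1 : ℝ) / 2 < ⟪(V (G y) : E3), (u : E3)⟫ := hsub hyQ.2
      rw [hGV] at h2
      refine ⟨h2, ?_⟩
      by_contra hth
      have h3 := hcb (G y) ⟨⟨hyQ.2, h0⟩, hth⟩
      simp only [hGV] at h3
      have h4 := hM _ hyQ.2
      have h5 : ‖t • perp u (V y)‖ ≤ ‖perp u y‖ + ‖G y‖ := by
        rw [hpt]
        have := norm_sub_le (G y + t • perp u (V y)) (G y)
        rwa [add_sub_cancel_left] at this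
      rw [norm_smul, Real.norm_eq_abs] at h5
      have h6 : |h| * c ≤ |t| * ‖perp u (V y)‖ := mul_le_mul ht h3 hc.le (abs_nonneg _)
      linarith
    · exact Or.inr hyQ
  have hBO : B ⊆ O₁ := by
    -- The vertical fiber through a point of `S_u` supplies a point of the disc in `O₁`; it lies in
    -- the disc because `M < c * |h| - M`.
    refine (hB.subset_or_subset hO₁ hQ.isOpen_compl
      (Set.disjoint_compl_right_iff_subset.2 hO₁Q) hcover).resolve_right fun hBQ => ?_
    obtain ⟨k, hk⟩ := baseSpace_nonempty hV hu
    have hk' := mem_baseSpace.1 hk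
    have hku : ⟪k, (u : E3)⟫ = 0 := by rw [real_inner_comm]; exact hk'.1
    have hVk : V (k + h • (u : E3)) = u := by
      have := hV.integral k h
      rwa [hk'.2] at this
    have hkM := hM k (Metric.self_subset_cthickening K hk)
    have hGk : G (k + h • (u : E3)) = k := by
      simp only [G]
      rw [hVk, uu]
      module
    have hkB : k + h • (u : E3) ∈ B := by
      rw [hBmem]
      constructor
      · rw [inner_add_left, real_inner_smul_left, hku, uu]; ring
      · rw [perp_add, perp_smul, perp_of_inner_eq_zero hku]
        have : perp (u : E3) u = 0 := by unfold perp; rw [uu]; module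
        rw [this, smul_zero, add_zero]
        linarith
    have hkO : k + h • (u : E3) ∈ O₁ := by
      rw [hO₁mem, hGk, hVk, uu]
      exact ⟨by norm_num, Metric.self_subset_thickening hδ K hk⟩
    exact hBQ hkB (hO₁Q hkO)
  have hyO := (hO₁mem y).1 (hBO ((hBmem y).2 ⟨hh.symm, hy⟩))
  obtain ⟨h0, t, ht, hpt⟩ := hfoot y rfl hyO.1.le
  have hGM := hM _ (Metric.thickening_subset_cthickening _ _ hyO.2)
  have hpos : (0 : ℝ) ≤ ⟪(V y : E3), (u : E3)⟫ := by linarith [hyO.1]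
  have h5 : ‖t • perp u (V y)‖ ≤ ‖perp u y‖ + ‖G y‖ := by
    rw [hpt]
    have := norm_sub_le (G y + t • perp u (V y)) (G y)
    rwa [add_sub_cancel_left] at this
  rw [norm_smul, Real.norm_eq_abs] at h5
  calc ‖(V y : E3) - u‖ * |h| ≤ 2 * ‖perp u (V y)‖ * |t| :=
        mul_le_mul (norm_sub_le_of_inner_nonneg _ _ hpos) ht (abs_nonneg _) (by positivity)
    _ ≤ 2 * (‖perp u y‖ + M) := by linarith

lemma continuityAtInfinity_of_isCompact (hV : IsLineFibration V) {u : S2} (hu : u ∈ directions V)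
    (hK : IsCompact (baseSpace V u)) : ContinuityAtInfinity V u := by
  intro p hp hpu
  obtain ⟨c, hc, M, hM⟩ := exists_cone_bound hV hu hK
  have uu := inner_self_coe u
  have h1 : Tendsto (fun k => |⟪‖p k‖⁻¹ • p k, (u : E3)⟫|) atTop (𝓝 1) := by
    have hcont : Continuous fun y : E3 => |⟪y, (u : E3)⟫| := by fun_prop
    have ha := hcont.tendsto (u : E3)
    have hb := hcont.tendsto (-(u : E3))
    rw [inner_neg_left, abs_neg] at hb
    rw [uu, abs_one] at ha hb
    exact (ha.sup hb).comp hpu |>.mono_right (by simp)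
  have h2 : Tendsto (fun k => ‖perp u (‖p k‖⁻¹ • p k)‖) atTop (𝓝 0) := by
    have hcont : Continuous fun y : E3 => ‖perp u y‖ := (continuous_perp u).norm
    have h0 : perp (u : E3) u = 0 := by unfold perp; rw [uu]; module
    have ha := hcont.tendsto (u : E3)
    have hb := hcont.tendsto (-(u : E3))
    rw [← neg_one_smul ℝ (u : E3), perp_smul] at hb
    rw [h0] at ha hb
    rw [neg_one_smul] at hb
    simp only [smul_zero, norm_zero] at ha hb
    exact (ha.sup hb).comp hpu |>.mono_right (by simp)
  have h3 : Tendsto (fun k => ‖p k‖⁻¹) atTop (𝓝 0) := tendsto_inv_atTop_zero.comp hp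
  have h4 : ∀ᶠ k in atTop, 0 < ‖p k‖ := hp.eventually (eventually_gt_atTop 0)
  have hscale1 : ∀ k, |⟪‖p k‖⁻¹ • p k, (u : E3)⟫| = ‖p k‖⁻¹ * |⟪p k, (u : E3)⟫| := fun k => by
    rw [real_inner_smul_left, abs_mul, abs_of_nonneg (inv_nonneg.2 (norm_nonneg _))]
  have hscale2 : ∀ k, ‖perp u (‖p k‖⁻¹ • p k)‖ = ‖p k‖⁻¹ * ‖perp u (p k)‖ := fun k => by
    rw [perp_smul, norm_smul, Real.norm_of_nonneg (inv_nonneg.2 (norm_nonneg _))]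
  simp only [hscale1] at h1
  simp only [hscale2] at h2
  -- Divided by `‖p k‖`, the cone conditions compare `0` with `c` in the limit, and the bound on `‖V
  -- - u‖` becomes a quotient tending to `0`.
  have h5 : Tendsto (fun k => c * (‖p k‖⁻¹ * |⟪p k, (u : E3)⟫|) - ‖p k‖⁻¹ * M) atTop (𝓝 c) := by
    simpa using (h1.const_mul c).sub (h3.mul_const M)
  have h6 : ∀ᶠ k in atTop, ‖p k‖⁻¹ * M < c * (‖p k‖⁻¹ * |⟪p k, (u : E3)⟫|) - ‖p k‖⁻¹ * M := by
    have : Tendsto (fun k => ‖p k‖⁻¹ * M) atTop (𝓝 0) := by simpa using h3.mul_const M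
    exact this.eventually_lt h5 hc
  have h7 : ∀ᶠ k in atTop, ‖p k‖⁻¹ * ‖perp u (p k)‖
      < c * (‖p k‖⁻¹ * |⟪p k, (u : E3)⟫|) - ‖p k‖⁻¹ * M := h2.eventually_lt h5 hc
  rw [tendsto_subtype_rng, tendsto_iff_norm_sub_tendsto_zero]
  have hlim : Tendsto (fun k => 2 * (‖p k‖⁻¹ * ‖perp u (p k)‖ + ‖p k‖⁻¹ * M) /
      (‖p k‖⁻¹ * |⟪p k, (u : E3)⟫|)) atTop (𝓝 0) := by
    have := ((h2.add (h3.mul_const M)).const_mul 2).div h1 one_ne_zero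
    simpa [Pi.div_def] using this
  refine squeeze_zero' (Eventually.of_forall fun _ => norm_nonneg _) ?_ hlim
  filter_upwards [h4, h6, h7, h1.eventually (lt_mem_nhds one_pos)] with k hk0 hk1 hk2 hk3
  have hinv := inv_pos.2 hk0
  have h8 := hM (p k) (by
    refine lt_of_mul_lt_mul_left (a := ‖p k‖⁻¹) ?_ hinv.le
    linarith) (by
    refine lt_of_mul_lt_mul_left (a := ‖p k‖⁻¹) ?_ hinv.le
    linarith)
  rw [le_div_iff₀ hk3]
  have := mul_le_mul_of_nonneg_left h8 hinv.le
  linarith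

/-! ### Fibers inside parallel planes and convexity of the set of directions -/

/-- Near a fiber whose base space is compact, the directions are uniformly close. -/
lemma eventually_forall_norm_sub_lt (hV : IsLineFibration V) {v : S2} {q₀ : E3} (hq : V q₀ = v)
    (hK : IsCompact (baseSpace V v)) {ε : ℝ} (hε : 0 < ε) :
    ∀ᶠ q in 𝓝 q₀, ∀ t : ℝ, ‖(V (q + t • (v : E3)) : E3) - v‖ < ε := by
  obtain ⟨c, hc, M, hM⟩ := exists_cone_bound hV ⟨q₀, hq⟩ hK
  set C := ‖perp v q₀‖ + 1 with hC
  set A := |⟪q₀, (v : E3)⟫| + 1 with hA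
  have hC0 : 0 ≤ C := by positivity
  -- Beyond `T` the point is so high that it satisfies both cone conditions and the cone bound falls
  -- below `ε`. Heights in `[-T, T]` are handled by compactness.
  set T := A + (|M| + |M| + C + 1) / c + 2 * (C + |M|) / ε + 1 with hT
  have hnear : ∀ᶠ q in 𝓝 q₀, ‖perp v q‖ < C :=
    (continuous_perp (v : E3)).norm.continuousAt.eventually (gt_mem_nhds (by simp [hC]))
  have hnear' : ∀ᶠ q in 𝓝 q₀, |⟪q, (v : E3)⟫| < A := by
    have h1 : Continuous fun q : E3 => |⟪q, (v : E3)⟫| := by fun_prop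
    exact h1.continuousAt.eventually (gt_mem_nhds (by simp [hA]))
  have hcomp : ∀ᶠ q in 𝓝 q₀, ∀ t ∈ Set.Icc (-T) T, ‖(V (q + t • (v : E3)) : E3) - v‖ < ε := by
    refine isCompact_Icc.eventually_forall_of_forall_eventually fun t _ => ?_
    have h1 : Continuous fun z : E3 × ℝ => ‖(V (z.1 + z.2 • (v : E3)) : E3) - v‖ :=
      ((hV.continuous_coe.comp (by fun_prop)).sub continuous_const).norm
    refine h1.continuousAt.eventually (gt_mem_nhds ?_)
    have h2 := hV.integral q₀ t
    rw [hq] at h2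
    simp only [h2, sub_self, norm_zero]
    exact hε
  filter_upwards [hnear, hnear', hcomp] with q hq1 hq2 hq3 t
  by_cases ht : t ∈ Set.Icc (-T) T
  · exact hq3 t ht
  have htT : T < |t| := by
    rw [← not_le, abs_le]
    exact ht
  have hin : ⟪q + t • (v : E3), (v : E3)⟫ = ⟪q, (v : E3)⟫ + t := by
    rw [inner_add_left, real_inner_smul_left, inner_self_coe, mul_one]
  have hpe : perp v (q + t • (v : E3)) = perp v q := by
    have h0 : perp (v : E3) v = 0 := by unfold perp; rw [inner_self_coe]; module
    rw [perp_add, perp_smul, h0, smul_zero, add_zero]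
  have hbig : T - A < |⟪q + t • (v : E3), (v : E3)⟫| := by
    rw [hin]
    have := abs_sub_abs_le_abs_sub t (-⟪q, (v : E3)⟫)
    rw [abs_neg, sub_neg_eq_add, add_comm t] at this
    linarith
  set h := |⟪q + t • (v : E3), (v : E3)⟫| with hh
  have hMa := le_abs_self M
  have hMn := abs_nonneg M
  have h1 : (|M| + |M| + C + 1) / c < h := by
    have : 0 ≤ 2 * (C + |M|) / ε := by positivity
    linarith
  have h2 : 2 * (C + |M|) / ε < h := by
    have : 0 ≤ (|M| + |M| + C + 1) / c := by positivity
    linarith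
  rw [div_lt_iff₀ hc] at h1
  rw [div_lt_iff₀ hε] at h2
  have h3 := hM (q + t • (v : E3)) (by linarith) (by rw [hpe]; linarith)
  rw [hpe] at h3
  have hpos : 0 < h := by
    refine lt_of_mul_lt_mul_right (a := ε) ?_ hε.le
    have : 0 ≤ 2 * (C + |M|) := by positivity
    linarith
  refine lt_of_mul_lt_mul_right (a := h) ?_ hpos.le
  linarith

/-- Every plane parallel to a fiber with compact base space contains a fiber. -/
lemma exists_tangent (hV : IsLineFibration V) {u : S2} {n : E3} (hF : IsFrame u e n)
    (hu : u ∈ directions V) (hK : IsCompact (baseSpace V u)) (t : ℝ) :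
    ∃ y : E3, ⟪y, n⟫ = t ∧ ⟪(V y : E3), n⟫ = 0 := by
  by_contra! h
  obtain ⟨y₀, hy₀⟩ := baseSpace_nonempty hV hu
  have hy₀' := mem_baseSpace.1 hy₀
  have hmu := neg_notMem_directions hV hu hK
  have hv₀ : Vert V u y₀ := by left; rw [hy₀'.2]
  set t₀ := ⟪y₀, n⟫ with ht₀
  -- If all fibers meeting the plane at level `t` are transverse to it, follow them to the parallel
  -- plane through `y₀` and record the `e`-coordinate. It never vanishes, as that would mean hitting
  -- the vertical fiber through `y₀`; yet it takes both signs.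
  let g : E3 → ℝ := fun y => ⟪y + ((t₀ - t) / ⟪(V y : E3), n⟫) • (V y : E3) - y₀, e⟫
  have hpre : IsPreconnected {y : E3 | ⟪y, n⟫ = t} := by
    apply Convex.isPreconnected
    intro a ha b hb s r _ _ hsr
    have ha' : ⟪a, n⟫ = t := ha
    have hb' : ⟪b, n⟫ = t := hb
    change ⟪s • a + r • b, n⟫ = t
    rw [inner_add_left, real_inner_smul_left, real_inner_smul_left, ha', hb', ← add_mul, hsr,
      one_mul]
  have hg : ContinuousOn g {y : E3 | ⟪y, n⟫ = t} := by
    have h1 : ContinuousOn (fun y => y + ((t₀ - t) / ⟪(V y : E3), n⟫) • (V y : E3) - y₀)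
        {y : E3 | ⟪y, n⟫ = t} :=
      (continuousOn_id.add ((continuousOn_const.div (hV.continuous_inner n).continuousOn
        fun y hy => h y hy).smul hV.continuous_coe.continuousOn)).sub continuousOn_const
    exact h1.inner continuousOn_const
  have hg0 : ∀ y : E3, ⟪y, n⟫ = t → g y ≠ 0 := by
    intro y hy h0
    have hn := h y hy
    have hvert : Vert V u (y + ((t₀ - t) / ⟪(V y : E3), n⟫) • (V y : E3)) := by
      have h1 := hF.expand (y + ((t₀ - t) / ⟪(V y : E3), n⟫) • (V y : E3) - y₀)
      set z := ⟪y + ((t₀ - t) / ⟪(V y : E3), n⟫) • (V y : E3) - y₀, (u : E3)⟫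
      have h2 : ⟪y + ((t₀ - t) / ⟪(V y : E3), n⟫) • (V y : E3) - y₀, n⟫ = 0 := by
        rw [inner_sub_left, inner_add_left, real_inner_smul_left, hy, ← ht₀]
        field_simp
        ring
      rw [show ⟪y + ((t₀ - t) / ⟪(V y : E3), n⟫) • (V y : E3) - y₀, e⟫ = 0 from h0, h2] at h1
      have h3 : y + ((t₀ - t) / ⟪(V y : E3), n⟫) • (V y : E3) = y₀ + z • (u : E3) := by
        linear_combination (norm := module) (1 : ℝ) • h1
      rw [h3, vert_add_smul_iff hV]
      exact hv₀
    rw [vert_add_fiber_iff hV] at hvert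
    exact hn ((vert_iff hF y).1 hvert).2
  have hval : ∀ e' : E3, IsFrame u e' n →
      ∃ x : ℝ, 0 < x ∧ ∃ y : E3, ⟪y, n⟫ = t ∧
        y + ((t₀ - t) / ⟪(V y : E3), n⟫) • (V y : E3) - y₀ = x • e' := by
    intro e' hF'
    -- By compactness the ray along `e'` leaves `S_u`. At such a point the fiber is not vertical,
    -- hence transverse to the plane, and can be followed back to level `t`.
    have h1 : ∃ x : ℝ, 0 ≤ x ∧ V (y₀ + x • e') ≠ u := by
      by_contra! h1
      refine not_isCompact_of_ray (p := y₀) hF'.e_ne (fun x hx => ?_) hK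
      rw [mem_baseSpace]
      refine ⟨?_, h1 x hx⟩
      rw [inner_add_right, real_inner_smul_right, hy₀'.1, hF'.ue]
      ring
    obtain ⟨x, hx, hxu⟩ := h1
    have hx0 : x ≠ 0 := by
      rintro rfl
      rw [zero_smul, add_zero] at hxu
      exact hxu hy₀'.2
    set r := y₀ + x • e' with hr
    have hrn : ⟪r, n⟫ = t₀ := by
      rw [hr, inner_add_left, real_inner_smul_left, hF'.en]; ring
    have hrv : ¬ Vert V u r := by
      rintro (h2 | h2)
      · exact hxu (Subtype.ext h2)
      · exact hmu ⟨r, Subtype.ext (by rw [h2, coe_neg_sphere])⟩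
    have hrn' := inner_ne_zero_of_coplanar hV hF' hv₀ hrv (by
      rw [inner_sub_left, hrn, ← ht₀, sub_self])
    refine ⟨x, lt_of_le_of_ne hx hx0.symm, r + ((t - t₀) / ⟪(V r : E3), n⟫) • (V r : E3), ?_, ?_⟩
    · rw [inner_add_left, real_inner_smul_left, hrn]
      field_simp
      ring
    · rw [hV.integral, hr]
      module
  obtain ⟨x, hx, y, hy, hyx⟩ := hval e hF
  obtain ⟨x', hx', y', hy', hyx'⟩ := hval (-e) hF.neg_mid
  have hgy : g y = x := by
    simp only [g, hyx, real_inner_smul_left, hF.ee, mul_one]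
  have hgy' : g y' = -x' := by
    simp only [g, hyx', real_inner_smul_left, inner_neg_left, hF.ee]
    ring
  obtain ⟨w, hw, hw0⟩ := hpre.intermediate_value hy' hy hg
    (show (0 : ℝ) ∈ Set.Icc (g y') (g y) by rw [hgy, hgy']; constructor <;> linarith)
  exact hg0 w hw hw0

lemma exists_frame_of_inner_eq_zero {v n : E3} (vv : ⟪v, v⟫ = 1) (nn : ⟪n, n⟫ = 1)
    (vn : ⟪v, n⟫ = 0) : ∃ e, IsFrame v e n := by
  obtain ⟨e, hF⟩ := exists_frame vv nn vn
  exact ⟨e, hF.uu, hF.nn, hF.ee, hF.un, hF.ue, hF.ne⟩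

/-- Two fibers contained in the same plane have the same direction. -/
lemma eq_of_tangent (hV : IsLineFibration V) (hneg : ∀ v ∈ directions V, -v ∉ directions V)
    (nn : ⟪n, n⟫ = 1) {y y' : E3} (hyy' : ⟪y', n⟫ = ⟪y, n⟫) (hy : ⟪(V y : E3), n⟫ = 0)
    (hy' : ⟪(V y' : E3), n⟫ = 0) : V y' = V y := by
  obtain ⟨e, hF⟩ := exists_frame_of_inner_eq_zero (inner_self_coe (V y)) nn hy
  by_contra hne
  have hv : ¬ Vert V (V y) y' := by
    rintro (h | h)
    · exact hne (Subtype.ext h)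
    · exact hneg (V y) ⟨y, rfl⟩ ⟨y', Subtype.ext (by rw [h, coe_neg_sphere])⟩
  exact inner_ne_zero_of_coplanar hV hF (Or.inl rfl) hv
    (by rw [inner_sub_left, hyy', sub_self]) hy'

lemma eq_of_smul_eq_coe {u w : S2} {c : ℝ} (hc : 0 ≤ c) (h : (w : E3) = c • (u : E3)) : w = u := by
  have h1 : ‖(w : E3)‖ = 1 := norm_eq_of_mem_sphere w
  rw [h, norm_smul, norm_eq_of_mem_sphere, Real.norm_of_nonneg hc, mul_one] at h1
  rw [h1, one_smul] at h
  exact Subtype.ext h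

/-- In the plane at level `t`, the chosen fiber either is parallel to `v = V (Y t₀)` or meets the
line of direction `v` through the shifted point `q`. Along that whole line `V` is uniformly close to
`v`. -/
lemma continuous_tangent (hV : IsLineFibration V)
    (hK : ∀ v ∈ directions V, IsCompact (baseSpace V v)) (nn : ⟪n, n⟫ = 1) {Y : ℝ → E3}
    (hY : ∀ t, ⟪Y t, n⟫ = t) (hYn : ∀ t, ⟪(V (Y t) : E3), n⟫ = 0) :
    Continuous fun t => (V (Y t) : E3) := by
  rw [continuous_iff_continuousAt]
  intro t₀
  rw [ContinuousAt, Metric.tendsto_nhds]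
  intro ε hε
  set v : S2 := V (Y t₀) with hv
  have hq : Tendsto (fun t : ℝ => Y t₀ + (t - t₀) • n) (𝓝 t₀) (𝓝 (Y t₀)) := by
    have h1 : Continuous fun t : ℝ => Y t₀ + (t - t₀) • n := by fun_prop
    have := h1.tendsto t₀
    rwa [sub_self, zero_smul, add_zero] at this
  have hnear := eventually_forall_norm_sub_lt hV hv.symm (hK v ⟨_, hv.symm⟩) hε
  filter_upwards [hq.eventually hnear] with t ht
  rw [dist_eq_norm]
  by_cases hvert : Vert V v (Y t)
  · rcases hvert with h | h
    · rw [h, sub_self, norm_zero]; exact hε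
    · exact absurd ⟨Y t, Subtype.ext (by rw [h, coe_neg_sphere])⟩
        (neg_notMem_directions hV ⟨_, hv.symm⟩ (hK v ⟨_, hv.symm⟩))
  obtain ⟨e, hF⟩ := exists_frame_of_inner_eq_zero (inner_self_coe v) nn (hYn t₀)
  have hβ : ⟪(V (Y t) : E3), e⟫ ≠ 0 := fun h => hvert ((vert_iff hF _).2 ⟨h, hYn t⟩)
  set q := Y t₀ + (t - t₀) • n with hqdef
  set σ := -(⟪Y t - q, e⟫ / ⟪(V (Y t) : E3), e⟫) with hσ
  have hcross : Y t + σ • (V (Y t) : E3) =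
      q + (⟪Y t - q, (v : E3)⟫ + σ * ⟪(V (Y t) : E3), (v : E3)⟫) • (v : E3) := by
    have hqn : ⟪q, n⟫ = t := by
      rw [hqdef, inner_add_left, real_inner_smul_left, nn, hY]; ring
    apply hF.ext <;>
      simp only [inner_add_left, inner_sub_left, real_inner_smul_left, hF.uu, hF.ue, hF.un, hY,
        hYn, hqn]
    · ring
    · rw [hσ, inner_sub_left]
      field_simp
      ring
    · ring
  have := ht (⟪Y t - q, (v : E3)⟫ + σ * ⟪(V (Y t) : E3), (v : E3)⟫)
  rwa [← hcross, hV.integral] at this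

lemma isSphericallyConvex_directions (hV : IsLineFibration V)
    (hK : ∀ v ∈ directions V, IsCompact (baseSpace V v)) :
    IsSphericallyConvex (directions V) := by
  have hneg : ∀ v ∈ directions V, -v ∉ directions V := fun v hv =>
    neg_notMem_directions hV hv (hK v hv)
  intro u hu v hv huv w a b ha hb hw
  rcases ha.eq_or_lt with rfl | ha
  · rw [zero_smul, zero_add] at hw
    rwa [eq_of_smul_eq_coe hb hw]
  rcases hb.eq_or_lt with rfl | hb
  · rw [zero_smul, add_zero] at hw
    rwa [eq_of_smul_eq_coe ha.le hw]
  by_contra hwU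
  have uu := inner_self_coe u
  set c := ⟪(v : E3), (u : E3)⟫ with hc
  have hud : ⟪(u : E3), (v : E3) - c • (u : E3)⟫ = 0 := by
    rw [inner_sub_right, real_inner_smul_right, uu, hc, real_inner_comm]; ring
  have hd : (v : E3) - c • (u : E3) ≠ 0 := by
    intro h0
    have h1 : (v : E3) = c • (u : E3) := sub_eq_zero.1 h0
    rcases le_total 0 c with h | h
    · obtain rfl := eq_of_smul_eq_coe h h1
      apply hwU
      rw [← add_smul] at hw
      rwa [eq_of_smul_eq_coe (by positivity) hw]
    · apply huv
      refine eq_of_smul_eq_coe (neg_nonneg.2 h) ?_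
      rw [h1, coe_neg_sphere]
      module
  obtain ⟨e, n, hF, hde⟩ := exists_frame_of_orthogonal uu hd hud
  set k := ‖(v : E3) - c • (u : E3)‖ with hk
  have hk0 : 0 < k := norm_pos_iff.2 hd
  have hve : (v : E3) = c • (u : E3) + k • e := by rw [← hde]; abel
  choose Y hY hYn using exists_tangent hV hF hu (hK u hu)
  have hcont := continuous_tangent hV hK hF.nn hY hYn
  let β : ℝ → ℝ := fun t => ⟪(V (Y t) : E3), e⟫ / k
  let α : ℝ → ℝ := fun t => ⟪(V (Y t) : E3), (u : E3)⟫ - c * β t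
  have hβc : Continuous β := (hcont.inner continuous_const).div_const k
  have hαc : Continuous α := (hcont.inner continuous_const).sub (hβc.const_mul c)
  have hexp : ∀ t, (V (Y t) : E3) = α t • (u : E3) + β t • (v : E3) := by
    intro t
    apply hF.ext <;>
      simp only [inner_add_left, real_inner_smul_left, hF.uu, hF.ue, hF.un, hve, hF.eu, hF.ee,
        hF.en, hYn, α, β] <;> field_simp <;> ring
  have hdir : ∀ y, ⟪(V y : E3), n⟫ = 0 → V (Y ⟪y, n⟫) = V y := fun y hy =>
    eq_of_tangent hV hneg hF.nn (hY _) hy (hYn _)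
  -- In the great circle of `u` and `v`, these are the open arc from `-v` to `w` through `u` and the
  -- complement of its closure. Neither endpoint is a direction, so the curve would have to stay on
  -- one side.
  let A : Set ℝ := {t | 0 < α t} ∩ {t | β t * a < α t * b}
  let B : Set ℝ := {t | α t < 0} ∪ {t | α t * b < β t * a}
  have hA : IsOpen A := (isOpen_lt continuous_const hαc).inter
    (isOpen_lt (hβc.mul_const a) (hαc.mul_const b))
  have hB : IsOpen B := (isOpen_lt hαc continuous_const).union
    (isOpen_lt (hαc.mul_const b) (hβc.mul_const a))
  have hAB : Disjoint A B := by
    rw [Set.disjoint_left]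
    rintro t ⟨h1, h2⟩ (h3 | h3)
    · exact lt_asymm (show 0 < α t from h1) h3
    · exact lt_asymm (show β t * a < α t * b from h2) h3
  have hcover : Set.univ ⊆ A ∪ B := by
    intro t _
    by_contra hAB
    have hnA : ¬ (0 < α t ∧ β t * a < α t * b) := fun h => hAB (Or.inl h)
    have hnB1 : ¬ α t < 0 := fun h => hAB (Or.inr (Or.inl h))
    have hnB2 : ¬ α t * b < β t * a := fun h => hAB (Or.inr (Or.inr h))
    rw [not_lt] at hnB1 hnB2
    rcases hnB1.eq_or_lt with h0 | h0
    · have hβ : β t ≤ 0 := by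
        rw [← h0, zero_mul] at hnB2
        exact nonpos_of_mul_nonpos_left hnB2 ha
      apply hneg v hv
      refine ⟨Y t, eq_of_smul_eq_coe (neg_nonneg.2 hβ) ?_⟩
      rw [hexp, ← h0, coe_neg_sphere]
      module
    · have h1 : α t * b = β t * a := le_antisymm (not_lt.1 fun h => hnA ⟨h0, h⟩) hnB2
      apply hwU
      refine ⟨Y t, eq_of_smul_eq_coe (c := α t / a) (by positivity) ?_⟩
      rw [hexp, hw]
      match_scalars
      · field_simp
      · field_simp
        linarith
  obtain ⟨yu, hyu⟩ := hu
  obtain ⟨yv, hyv⟩ := hv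
  have htu : ⟪yu, n⟫ ∈ A := by
    have h1 := hdir yu (by rw [hyu, hF.un])
    have hβ0 : β ⟪yu, n⟫ = 0 := by simp only [β, h1, hyu, hF.ue, zero_div]
    have hα1 : α ⟪yu, n⟫ = 1 := by simp only [α, hβ0, h1, hyu, uu]; ring
    constructor
    · change 0 < α ⟪yu, n⟫
      rw [hα1]; exact one_pos
    · change β ⟪yu, n⟫ * a < α ⟪yu, n⟫ * b
      rw [hα1, hβ0]; linarith
  have htv : ⟪yv, n⟫ ∈ B := by
    have h1 := hdir yv (by
      rw [hyv, hve, inner_add_left, real_inner_smul_left, real_inner_smul_left, hF.un, hF.en]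
      ring)
    have hve' : ⟪(v : E3), e⟫ = k := by
      rw [hve, inner_add_left, real_inner_smul_left, real_inner_smul_left, hF.ue, hF.ee]
      ring
    have hβ1 : β ⟪yv, n⟫ = 1 := by
      simp only [β, h1, hyv, hve']
      exact div_self hk0.ne'
    have hα0 : α ⟪yv, n⟫ = 0 := by simp only [α, hβ1, h1, hyv, ← hc]; ring
    right
    change α ⟪yv, n⟫ * b < β ⟪yv, n⟫ * a
    rw [hα0, hβ1]; linarith
  rcases isPreconnected_univ.subset_or_subset hA hB hAB hcover with h | h
  · exact Set.disjoint_left.1 hAB (h trivial) htv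
  · exact Set.disjoint_left.1 hAB htu (h trivial)

/-! ### Recession directions of base spaces -/

/-- An unbounded sequence in a closed convex set yields a ray in a limiting direction. -/
lemma exists_tendsto_direction {S : Set E3} (hcl : IsClosed S) (hcv : Convex ℝ S) {r : E3}
    (hr : r ∈ S) {x : ℕ → E3} (hx : ∀ k, x k ∈ S) (hfar : ∀ k : ℕ, (k : ℝ) < ‖x k - r‖) :
    ∃ (d : E3) (φ : ℕ → ℕ), ‖d‖ = 1 ∧ StrictMono φ ∧
      Tendsto (fun k => ‖x (φ k) - r‖⁻¹ • (x (φ k) - r)) atTop (𝓝 d) ∧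
      ∀ c : ℝ, 0 ≤ c → r + c • d ∈ S := by
  have hpos : ∀ k, 0 < ‖x k - r‖ := fun k => lt_of_le_of_lt (Nat.cast_nonneg k) (hfar k)
  have hsph : ∀ k, ‖x k - r‖⁻¹ • (x k - r) ∈ Metric.sphere (0 : E3) 1 := fun k => by
    rw [mem_sphere_zero_iff_norm, norm_smul, norm_inv, norm_norm, inv_mul_cancel₀ (hpos k).ne']
  obtain ⟨d, hd, φ, hφ, hlim⟩ := (isCompact_sphere (0 : E3) 1).tendsto_subseq hsph
  refine ⟨d, φ, mem_sphere_zero_iff_norm.1 hd, hφ, hlim, fun c hc => ?_⟩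
  refine hcl.mem_of_tendsto (tendsto_const_nhds.add (hlim.const_smul c)) ?_
  obtain ⟨N, hN⟩ := exists_nat_ge c
  filter_upwards [eventually_ge_atTop N] with k hk
  have h1 : c ≤ ‖x (φ k) - r‖ := by
    refine hN.trans (le_trans ?_ (hfar (φ k)).le)
    exact_mod_cast hk.trans (hφ.id_le k)
  have h2 := hcv.add_smul_sub_mem hr (hx (φ k)) (t := c * ‖x (φ k) - r‖⁻¹)
    ⟨mul_nonneg hc (inv_nonneg.2 (norm_nonneg _)), by
      rw [← div_eq_mul_inv, div_le_one (hpos _)]; exact h1⟩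
  rw [mul_smul] at h2
  exact h2

lemma exists_ray {S : Set E3} (hcl : IsClosed S) (hcv : Convex ℝ S) (hS : ¬ IsCompact S) {r : E3}
    (hr : r ∈ S) : ∃ d : E3, ‖d‖ = 1 ∧ ∀ c : ℝ, 0 ≤ c → r + c • d ∈ S := by
  have h : ∀ k : ℕ, ∃ x ∈ S, (k : ℝ) < ‖x - r‖ := by
    by_contra! h
    obtain ⟨k, hk⟩ := h
    apply hS
    refine (isCompact_closedBall r k).of_isClosed_subset hcl fun x hx => ?_
    rw [mem_closedBall_iff_norm]
    exact hk x hx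
  choose x hx hfar using h
  obtain ⟨d, φ, hd, -, -, h⟩ := exists_tendsto_direction hcl hcv hr hx hfar
  exact ⟨d, hd, h⟩

/-- A salient closed convex cone has a linear functional positive on its nonzero elements. -/
lemma exists_inner_pos {C : Set E3} (hcl : IsClosed C) (hcv : Convex ℝ C)
    (h0 : (0 : E3) ∈ C) (hcone : ∀ x ∈ C, ∀ c : ℝ, 0 ≤ c → c • x ∈ C)
    (hsal : ∀ x ∈ C, -x ∈ C → x = 0) : ∃ e : E3, ∀ x ∈ C, x ≠ 0 → 0 < ⟪x, e⟫ := by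
  have hsep : ∀ d ∈ C, d ≠ 0 → ∃ e : E3, (∀ x ∈ C, 0 ≤ ⟪x, e⟫) ∧ 0 < ⟪d, e⟫ := by
    intro d hd hd0
    have hnd : -d ∉ C := fun h => hd0 (hsal d hd h)
    obtain ⟨f, s, hf, hs⟩ := geometric_hahn_banach_closed_point hcv hcl hnd
    have hs0 : 0 < s := by simpa using hf 0 h0
    have hrep : ∀ x, ⟪x, -(InnerProductSpace.toDual ℝ E3).symm f⟫ = -f x := fun x => by
      rw [inner_neg_right, real_inner_comm, InnerProductSpace.toDual_symm_apply]
    refine ⟨-(InnerProductSpace.toDual ℝ E3).symm f, fun x hx => ?_, ?_⟩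
    · rw [hrep, neg_nonneg]
      by_contra! hfx
      have h1 := hf _ (hcone x hx (s / f x) (by positivity))
      rw [map_smul, smul_eq_mul, div_mul_cancel₀ _ hfx.ne'] at h1
      exact lt_irrefl _ h1
    · rw [hrep, ← map_neg]
      exact hs0.trans hs
  have hcomp : IsCompact (C ∩ Metric.sphere (0 : E3) 1) := (isCompact_sphere _ _).inter_left hcl
  have key : ∃ e : E3, (∀ x ∈ C, 0 ≤ ⟪x, e⟫) ∧
      ∀ x ∈ C ∩ Metric.sphere (0 : E3) 1, x ∈ C → 0 < ⟪x, e⟫ := by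
    -- Finitely many functionals, each nonnegative on `C` and positive near one point of the unit
    -- sphere, add up to one positive on all of it.
    refine hcomp.induction_on (p := fun s => ∃ e : E3, (∀ x ∈ C, 0 ≤ ⟪x, e⟫) ∧
      ∀ x ∈ s, x ∈ C → 0 < ⟪x, e⟫) ⟨0, by simp, by simp⟩ ?_ ?_ ?_
    · rintro s t hst ⟨e, h1, h2⟩
      exact ⟨e, h1, fun x hx => h2 x (hst hx)⟩
    · rintro s t ⟨e, h1, h2⟩ ⟨e', h1', h2'⟩
      refine ⟨e + e', fun x hx => ?_, ?_⟩
      · rw [inner_add_right]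
        exact add_nonneg (h1 x hx) (h1' x hx)
      · rintro x (hx | hx) hxC <;> rw [inner_add_right]
        · exact add_pos_of_pos_of_nonneg (h2 x hx hxC) (h1' x hxC)
        · exact add_pos_of_nonneg_of_pos (h1 x hxC) (h2' x hx hxC)
    · rintro d ⟨hdC, hd⟩
      have hd0 : d ≠ 0 := by
        rintro rfl
        simp at hd
      obtain ⟨e, h1, h2⟩ := hsep d hdC hd0
      have hcont : Continuous fun x : E3 => ⟪x, e⟫ := by fun_prop
      refine ⟨{x | 0 < ⟪x, e⟫}, mem_nhdsWithin_of_mem_nhds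
        (hcont.continuousAt.eventually (lt_mem_nhds h2)), e, h1, fun x hx _ => hx⟩
  obtain ⟨e, -, he⟩ := key
  refine ⟨e, fun x hx hx0 => ?_⟩
  have hn := norm_pos_iff.2 hx0
  have h1 : ‖x‖⁻¹ • x ∈ C := hcone x hx _ (inv_nonneg.2 hn.le)
  have h2 := he _ ⟨h1, by
    rw [mem_sphere_zero_iff_norm, norm_smul, norm_inv, norm_norm, inv_mul_cancel₀ hn.ne']⟩ h1
  rw [real_inner_smul_left] at h2
  exact (mul_pos_iff_of_pos_left (inv_pos.2 hn)).1 h2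

/-- Sliding `a` and `b` along their common direction into `V a`'s orthogonal plane reduces this to
convexity of the base space. -/
lemma eq_of_between (hV : IsLineFibration V) (hP : ¬ IsPlanar V) {a b : E3} (hab : V a = V b)
    {c : ℝ} (h0 : 0 ≤ c) (h1 : c ≤ 1) : V (a + c • (b - a)) = V a := by
  obtain ⟨s, hs⟩ := exists_mem_baseSpace hV a
  obtain ⟨t, ht⟩ := exists_mem_baseSpace hV b
  rw [← hab] at ht
  have h := (mem_baseSpace.1 (add_smul_sub_mem_baseSpace hV hP hs ht h0 h1)).2
  have h2 : a + s • (V a : E3) + c • (b + t • (V a : E3) - (a + s • (V a : E3)))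
      = a + c • (b - a) + (s + c * (t - s)) • (V a : E3) := by module
  rw [h2] at h
  have h3 : Vert V (V a) (a + c • (b - a) + (s + c * (t - s)) • (V a : E3)) := by
    left; rw [h]
  have h4 := (vert_add_smul_iff hV _).1 h3
  rw [← h4.add_smul hV, h]

lemma convex_fiber (hV : IsLineFibration V) (hP : ¬ IsPlanar V) (v : S2) :
    Convex ℝ {y | V y = v} := by
  rw [convex_iff_forall_pos]
  intro a ha b hb s t hs ht hst
  have ha' : V a = v := ha
  have hb' : V b = v := hb
  have h := eq_of_between hV hP (ha'.trans hb'.symm) ht.le (by linarith)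
  have h1 : s • a + t • b = a + t • (b - a) := by
    rw [eq_sub_of_add_eq hst]; module
  change V (s • a + t • b) = v
  rw [h1, h, ha']

/-- The direction `d` is recessive for the points of direction `V r` at `r`. -/
def IsRecessive (V : E3 → S2) (r d : E3) : Prop := ∀ c : ℝ, 0 ≤ c → V (r + c • d) = V r

lemma IsRecessive.of_tendsto (hV : IsLineFibration V) {r d : ℕ → E3} {r' d' : E3}
    (h : ∀ k, IsRecessive V (r k) (d k)) (hr : Tendsto r atTop (𝓝 r'))
    (hd : Tendsto d atTop (𝓝 d')) : IsRecessive V r' d' := by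
  intro c hc
  have h1 := (hV.continuous.tendsto _).comp (hr.add (hd.const_smul c))
  have h2 := (hV.continuous.tendsto _).comp hr
  refine tendsto_nhds_unique h1 (h2.congr fun k => ?_)
  exact (h k c hc).symm

/-- As for any closed convex set, recession directions do not depend on the base point: `r' + c • d`
is the limit of points on segments from `r'` to far points of the ray at `r`. -/
lemma IsRecessive.of_eq (hV : IsLineFibration V) (hP : ¬ IsPlanar V) {r d r' : E3}
    (h : IsRecessive V r d) (hr : V r' = V r) : IsRecessive V r' d := by
  intro c hc
  have hlim : Tendsto (fun k : ℕ => r' + (1 / ((k : ℝ) + 1)) • (r - r') + c • d) atTop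
      (𝓝 (r' + (0 : ℝ) • (r - r') + c • d)) :=
    (tendsto_const_nhds.add (tendsto_one_div_add_atTop_nhds_zero_nat.smul_const _)).add_const _
  rw [zero_smul, add_zero] at hlim
  refine tendsto_nhds_unique ((hV.continuous.tendsto _).comp hlim)
    (tendsto_const_nhds.congr fun k => ?_)
  have hk : (0 : ℝ) < (k : ℝ) + 1 := by positivity
  have h1 := eq_of_between hV hP (a := r') (b := r + (c * ((k : ℝ) + 1)) • d)
    (by rw [hr, h _ (by positivity)]) (c := 1 / ((k : ℝ) + 1)) (by positivity)
    (by rw [div_le_one hk]; linarith [(Nat.cast_nonneg k : (0 : ℝ) ≤ k)])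
  rw [Function.comp_apply, ← h1]
  congr 1
  match_scalars <;> field_simp

/-- If base spaces are not compact, all points of a fiber transverse to `u^⊥` have recessive
directions in `u^⊥`. -/
lemma exists_isRecessive (hV : IsLineFibration V) (hP : ¬ IsPlanar V)
    (hS : ∀ v ∈ directions V, ¬ IsCompact (baseSpace V v)) {u r : E3}
    (hr : ⟪(V r : E3), u⟫ ≠ 0) : ∃ d, ‖d‖ = 1 ∧ ⟪d, u⟫ = 0 ∧ IsRecessive V r d := by
  set v := V r with hv
  obtain ⟨t, ht⟩ := exists_mem_baseSpace hV r
  rw [← hv] at ht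
  obtain ⟨d, hd, h⟩ := exists_ray (isClosed_baseSpace hV v) (convex_baseSpace hV hP v)
    (hS v ⟨r, rfl⟩) ht
  have hvd : ⟪(v : E3), d⟫ = 0 := by
    have h1 := (mem_baseSpace.1 (h 1 zero_le_one)).1
    rwa [inner_add_right, (mem_baseSpace.1 ht).1, one_smul, zero_add] at h1
  set μ := ⟪d, u⟫ / ⟪(v : E3), u⟫ with hμ
  -- The ray direction orthogonal to `v` is moved along `v` into `u^⊥`; sliding along fibers does
  -- not affect recessiveness.
  set d' := d - μ • (v : E3) with hd'
  have hd'0 : d' ≠ 0 := by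
    intro h0
    have h1 : ⟪d, d⟫ = ⟪d', d⟫ := by
      rw [hd', inner_sub_left, real_inner_smul_left, hvd]; ring
    rw [h0, inner_zero_left, real_inner_self_eq_norm_sq, hd] at h1
    norm_num at h1
  have hd'u : ⟪d', u⟫ = 0 := by
    rw [hd', inner_sub_left, real_inner_smul_left, hμ]
    field_simp
    ring
  have hrec : IsRecessive V r d' := by
    intro c hc
    have h1 := (mem_baseSpace.1 (h c hc)).2
    have h2 : r + c • d' + (t + c * μ) • (v : E3) = r + t • (v : E3) + c • d := by
      rw [hd']; module
    have h3 : Vert V v (r + c • d' + (t + c * μ) • (v : E3)) := by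
      left
      rw [h2, h1]
    have h4 := ((vert_add_smul_iff hV _).1 h3).add_smul hV (t + c * μ)
    rw [h2, h1] at h4
    exact h4.symm
  have hn := norm_pos_iff.2 hd'0
  refine ⟨‖d'‖⁻¹ • d', ?_, ?_, fun c hc => ?_⟩
  · rw [norm_smul, norm_inv, norm_norm, inv_mul_cancel₀ hn.ne']
  · rw [real_inner_smul_left, hd'u, mul_zero]
  · rw [smul_smul]
    exact hrec _ (by positivity)

/-- The recession cone of `S_u` is salient, hence lies strictly on one side of a line. -/
lemma exists_frame_recessive (hV : IsLineFibration V) (hP : ¬ IsPlanar V)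
    (hS : ∀ v ∈ directions V, ¬ IsCompact (baseSpace V v)) {u : S2} {p : E3}
    (hp : V p = u) : ∃ e n, IsFrame (u : E3) e n ∧ ∃ c > 0, ∀ d, ‖d‖ = 1 → ⟪d, (u : E3)⟫ = 0 →
      IsRecessive V p d → c ≤ ⟪d, e⟫ := by
  have uu := inner_self_coe u
  let C : Set E3 := {d | ⟪d, (u : E3)⟫ = 0} ∩ {d | IsRecessive V p d}
  have hcl : IsClosed C := by
    refine (isClosed_eq (by fun_prop) continuous_const).inter ?_
    have : {d | IsRecessive V p d} = ⋂ c : ℝ, ⋂ _ : 0 ≤ c, {d | V (p + c • d) = V p} := by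
      ext d
      simp [IsRecessive]
    rw [this]
    refine isClosed_iInter fun c => isClosed_iInter fun _ => ?_
    exact isClosed_eq (hV.continuous.comp (by fun_prop)) continuous_const
  have hcone : ∀ x ∈ C, ∀ c : ℝ, 0 ≤ c → c • x ∈ C := by
    rintro x ⟨hx, hx'⟩ c hc
    have hx0 : ⟪x, (u : E3)⟫ = 0 := hx
    refine ⟨?_, fun b hb => ?_⟩
    · change ⟪c • x, (u : E3)⟫ = 0
      rw [real_inner_smul_left, hx0, mul_zero]
    · rw [smul_smul]
      exact hx' _ (mul_nonneg hb hc)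
  have hcv : Convex ℝ C := by
    rintro x ⟨hx, hx'⟩ y ⟨hy, hy'⟩ a b ha hb hab
    have hx0 : ⟪x, (u : E3)⟫ = 0 := hx
    have hy0 : ⟪y, (u : E3)⟫ = 0 := hy
    refine ⟨?_, fun c hc => ?_⟩
    · change ⟪a • x + b • y, (u : E3)⟫ = 0
      rw [inner_add_left, real_inner_smul_left, real_inner_smul_left, hx0, hy0]; ring
    · have h1 := convex_fiber hV hP (V p) (hx' c hc) (hy' c hc) ha hb hab
      have h2 : a • (p + c • x) + b • (p + c • y) = p + c • (a • x + b • y) := by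
        rw [eq_sub_of_add_eq hab]; module
      rw [h2] at h1
      exact h1
  have h0 : (0 : E3) ∈ C := ⟨by simp, fun c _ => by rw [smul_zero, add_zero]⟩
  have hsal : ∀ x ∈ C, -x ∈ C → x = 0 := by
    rintro x ⟨hx, hx'⟩ ⟨-, hnx⟩
    by_contra hx0
    have hxu : ⟪(u : E3), x⟫ = 0 := by rw [real_inner_comm]; exact hx
    obtain ⟨e, n, hF, hxe⟩ := exists_frame_of_orthogonal uu hx0 hxu
    -- Two opposite recession directions would give a full line of vertical fibers orthogonal to
    -- `u`.
    apply hP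
    refine isPlanar_of_line hV hF p fun c => ?_
    left
    have hn := norm_pos_iff.2 hx0
    rw [← hp]
    congr 1
    rcases le_total 0 c with hc | hc
    · have h1 := hx' (c / ‖x‖) (by positivity)
      have h2 : (c / ‖x‖) • x = c • e := by
        nth_rw 2 [hxe]
        rw [smul_smul]
        field_simp
      rwa [h2] at h1
    · have h1 := hnx (-(c / ‖x‖)) (neg_nonneg.2 (div_nonpos_of_nonpos_of_nonneg hc hn.le))
      have h2 : (-(c / ‖x‖)) • -x = c • e := by
        rw [neg_smul_neg]
        nth_rw 2 [hxe]
        rw [smul_smul]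
        field_simp
      rwa [h2] at h1
  obtain ⟨w, hw⟩ := exists_inner_pos hcl hcv h0 hcone hsal
  have hcomp : IsCompact (C ∩ Metric.sphere (0 : E3) 1) := (isCompact_sphere _ _).inter_left hcl
  set w' := perp u w with hw'
  have hww' : ∀ d, ⟪d, (u : E3)⟫ = 0 → ⟪d, w'⟫ = ⟪d, w⟫ := fun d hd => by
    rw [hw']
    unfold perp
    rw [inner_sub_right, real_inner_smul_right, hd, mul_zero, sub_zero]
  obtain ⟨d₀, hd₀, hd₀u, hd₀r⟩ := exists_isRecessive hV hP hS (u := (u : E3)) (r := p)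
    (by rw [hp, uu]; exact one_ne_zero)
  have hw'0 : w' ≠ 0 := by
    intro h
    have h1 := hw d₀ ⟨hd₀u, hd₀r⟩ (by rintro rfl; simp at hd₀)
    rw [← hww' d₀ hd₀u, h, inner_zero_right] at h1
    exact lt_irrefl _ h1
  have huw' : ⟪(u : E3), w'⟫ = 0 := by
    rw [hw']
    unfold perp
    rw [inner_sub_right, real_inner_smul_right, uu, real_inner_comm]; ring
  obtain ⟨e, n, hF, hwe⟩ := exists_frame_of_orthogonal uu hw'0 huw'
  have hn := norm_pos_iff.2 hw'0
  obtain ⟨c, hc, hcb⟩ := hcomp.exists_forall_le' (a := 0) (f := fun d => ⟪d, e⟫)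
    (by fun_prop) (by
      rintro d ⟨⟨hdu, hdr⟩, hd⟩
      have h1 := hw d ⟨hdu, hdr⟩ (by rintro rfl; simp at hd)
      rw [← hww' d hdu, hwe, real_inner_smul_right] at h1
      exact (mul_pos_iff_of_pos_left hn).1 h1)
  exact ⟨e, n, hF, c, hc, fun d hd hdu hdr => hcb d ⟨⟨hdu, hdr⟩, mem_sphere_zero_iff_norm.2 hd⟩⟩

/-- Sublevel sets of a functional positive on the recession cone are compact. -/
lemma isCompact_sublevel (hV : IsLineFibration V) (hP : ¬ IsPlanar V) {u : S2} {p e : E3}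
    (hp : p ∈ baseSpace V u) {c : ℝ} (hc : 0 < c)
    (h : ∀ d, ‖d‖ = 1 → ⟪d, (u : E3)⟫ = 0 → IsRecessive V p d → c ≤ ⟪d, e⟫) :
    IsCompact (baseSpace V u ∩ {y | ⟪y - p, e⟫ ≤ 0}) := by
  by_contra hcomp
  have hcl : IsClosed (baseSpace V u ∩ {y | ⟪y - p, e⟫ ≤ 0}) :=
    (isClosed_baseSpace hV u).inter (isClosed_le (by fun_prop) continuous_const)
  have hk : ∀ k : ℕ, ∃ x ∈ baseSpace V u ∩ {y | ⟪y - p, e⟫ ≤ 0}, (k : ℝ) < ‖x - p‖ := by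
    by_contra! h
    obtain ⟨k, hk⟩ := h
    apply hcomp
    refine (isCompact_closedBall p k).of_isClosed_subset hcl fun x hx => ?_
    rw [mem_closedBall_iff_norm]
    exact hk x hx
  choose x hx hfar using hk
  obtain ⟨d, φ, hd, -, hlim, hray⟩ := exists_tendsto_direction (isClosed_baseSpace hV u)
    (convex_baseSpace hV hP u) hp (fun k => (hx k).1) hfar
  have hp' := mem_baseSpace.1 hp
  have hdu : ⟪d, (u : E3)⟫ = 0 := by
    have h1 := (mem_baseSpace.1 (hray 1 zero_le_one)).1
    rw [inner_add_right, hp'.1, one_smul, zero_add] at h1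
    rwa [real_inner_comm]
  have hrec : IsRecessive V p d := fun c hc => by
    rw [(mem_baseSpace.1 (hray c hc)).2, hp'.2]
  have h1 := h d hd hdu hrec
  have h2 : ⟪d, e⟫ ≤ 0 := by
    refine le_of_tendsto (hlim.inner tendsto_const_nhds) (Eventually.of_forall fun k => ?_)
    rw [real_inner_smul_left]
    exact mul_nonpos_of_nonneg_of_nonpos (inv_nonneg.2 (norm_nonneg _)) (hx (φ k)).2
  linarith

/-- Recessive directions at points close to `S_u` are close to the recession cone of `S_u`. -/
lemma exists_recessive_bound (hV : IsLineFibration V) (hP : ¬ IsPlanar V) {u : S2} {p e : E3}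
    (hp : V p = u) {c : ℝ} (hc : 0 < c)
    (h : ∀ d, ‖d‖ = 1 → ⟪d, (u : E3)⟫ = 0 → IsRecessive V p d → c ≤ ⟪d, e⟫) {T : Set E3}
    (hT : IsCompact T) (hTu : ∀ s ∈ T, V s = u) :
    ∃ η > 0, ∀ s ∈ T, ∀ r, ‖r - s‖ < η → 0 < ⟪(V r : E3), (u : E3)⟫ ∧
      ∀ d, ‖d‖ = 1 → ⟪d, (u : E3)⟫ = 0 → IsRecessive V r d → c / 2 ≤ ⟪d, e⟫ := by
  have hO : IsOpen {y | 0 < ⟪(V y : E3), (u : E3)⟫} :=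
    isOpen_lt continuous_const (hV.continuous_inner u)
  obtain ⟨η₁, hη₁, hsub⟩ := hT.exists_thickening_subset_open hO (by
    intro s hs
    change 0 < ⟪(V s : E3), (u : E3)⟫
    rw [hTu s hs, inner_self_coe]
    exact one_pos)
  have key : ∃ η > 0, ∀ s ∈ T, ∀ r, ‖r - s‖ < η →
      ∀ d, ‖d‖ = 1 → ⟪d, (u : E3)⟫ = 0 → IsRecessive V r d → c / 2 ≤ ⟪d, e⟫ := by
    by_contra! hcon
    have hk : ∀ k : ℕ, (0 : ℝ) < 1 / ((k : ℝ) + 1) := fun k => by positivity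
    choose s hs r hr d hd hdu hrec hlt using fun k : ℕ => hcon _ (hk k)
    obtain ⟨s', hs', φ, hφ, hslim⟩ := hT.tendsto_subseq hs
    obtain ⟨d', hd', ψ, hψ, hdlim⟩ := (isCompact_sphere (0 : E3) 1).tendsto_subseq
      (x := fun k => d (φ k)) fun k => mem_sphere_zero_iff_norm.2 (hd _)
    have hslim' : Tendsto (fun k => s (φ (ψ k))) atTop (𝓝 s') := hslim.comp hψ.tendsto_atTop
    have hrlim : Tendsto (fun k => r (φ (ψ k))) atTop (𝓝 s') := by
      have h1 : Tendsto (fun k => r k - s k) atTop (𝓝 0) :=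
        squeeze_zero_norm (fun k => (hr k).le) tendsto_one_div_add_atTop_nhds_zero_nat
      have h2 := hslim'.add (h1.comp (hφ.tendsto_atTop.comp hψ.tendsto_atTop))
      rw [add_zero] at h2
      refine h2.congr fun k => ?_
      simp only [Function.comp_apply]
      abel
    have hrec' : IsRecessive V s' d' :=
      IsRecessive.of_tendsto hV (fun k => hrec (φ (ψ k))) hrlim hdlim
    have hdu' : ⟪d', (u : E3)⟫ = 0 :=
      tendsto_nhds_unique (hdlim.inner tendsto_const_nhds)
        (tendsto_const_nhds.congr fun k => (hdu (φ (ψ k))).symm)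
    have h1 := h d' (mem_sphere_zero_iff_norm.1 hd') hdu'
      (hrec'.of_eq hV hP (by rw [hp, hTu s' hs']))
    have h2 : ⟪d', e⟫ ≤ c / 2 :=
      le_of_tendsto (hdlim.inner tendsto_const_nhds) (Eventually.of_forall fun k => (hlt _).le)
    linarith
  obtain ⟨η₂, hη₂, h2⟩ := key
  refine ⟨min η₁ η₂, lt_min hη₁ hη₂, fun s hs r hr => ⟨?_, ?_⟩⟩
  · refine hsub (Metric.mem_thickening_iff.2 ⟨s, hs, ?_⟩)
    rw [dist_eq_norm]
    exact hr.trans_le (min_le_left _ _)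
  · exact h2 s hs r (hr.trans_le (min_le_right _ _))

/-! ### Noncompact base spaces force planarity -/

/-- A fibration all of whose base spaces are noncompact is planar. -/
lemma isPlanar_of_forall_not_isCompact (hV : IsLineFibration V)
    (hS : ∀ v ∈ directions V, ¬ IsCompact (baseSpace V v)) : IsPlanar V := by
  by_contra hP
  obtain ⟨p, hp⟩ := baseSpace_nonempty hV (⟨0, rfl⟩ : V 0 ∈ directions V)
  set u : S2 := V 0 with hu
  have hp' := mem_baseSpace.1 hp
  obtain ⟨e, f, hF, c, hc, hcone⟩ := exists_frame_recessive hV hP hS hp'.2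
  have hS' := isCompact_sublevel hV hP hp hc hcone
  -- the face of `S_u` on which the coordinate along `e` is minimal
  obtain ⟨m, hm, hmin⟩ := hS'.exists_isMinOn (f := fun y => ⟪y, e⟫) ⟨p, hp, by simp⟩
    (by fun_prop)
  have hmp : ⟪m, e⟫ ≤ ⟪p, e⟫ := by
    have h1 : ⟪m - p, e⟫ ≤ 0 := hm.2
    rw [inner_sub_left] at h1
    linarith
  have hmin' : ∀ y ∈ baseSpace V u, ⟪m, e⟫ ≤ ⟪y, e⟫ := by
    intro y hy
    by_cases h1 : ⟪y - p, e⟫ ≤ 0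
    · exact hmin ⟨hy, h1⟩
    · rw [inner_sub_left] at h1
      linarith
  set x₀ := ⟪m, e⟫ with hx₀
  set T : Set E3 := baseSpace V u ∩ {y | ⟪y, e⟫ = x₀} with hTdef
  have hT : IsCompact T := by
    refine hS'.of_isClosed_subset ((isClosed_baseSpace hV u).inter
      (isClosed_eq (by fun_prop) continuous_const)) ?_
    rintro y ⟨hy, hy'⟩
    refine ⟨hy, ?_⟩
    change ⟪y - p, e⟫ ≤ 0
    have h1 : ⟪y, e⟫ = x₀ := hy'
    rw [inner_sub_left]
    linarith
  have hTne : T.Nonempty := ⟨m, hm.1, rfl⟩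
  have hTmem : ∀ y, y ∈ T ↔ (⟪y, (u : E3)⟫ = 0 ∧ V y = u) ∧ ⟪y, e⟫ = x₀ := fun y => by
    rw [hTdef, Set.mem_inter_iff, mem_baseSpace, real_inner_comm]
    rfl
  have hTcv : Convex ℝ T := by
    refine (convex_baseSpace hV hP u).inter ?_
    intro a ha b hb s t _ _ hst
    have ha' : ⟪a, e⟫ = x₀ := ha
    have hb' : ⟪b, e⟫ = x₀ := hb
    change ⟪s • a + t • b, e⟫ = x₀
    rw [inner_add_left, real_inner_smul_left, real_inner_smul_left, ha', hb', ← add_mul, hst,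
      one_mul]
  obtain ⟨s₁, hs₁, hs₁min⟩ := hT.exists_isMinOn (f := fun y => ⟪y, f⟫) hTne (by fun_prop)
  obtain ⟨s₂, hs₂, hs₂max⟩ := hT.exists_isMaxOn (f := fun y => ⟪y, f⟫) hTne (by fun_prop)
  have h12 : ⟪s₁, f⟫ ≤ ⟪s₂, f⟫ := hs₁min hs₂
  have hs₁' := (hTmem _).1 hs₁
  have hs₂' := (hTmem _).1 hs₂
  obtain ⟨η, hη, hbound⟩ := exists_recessive_bound hV hP hp'.2 hc hcone hT
    fun s hs => ((hTmem s).1 hs).1.2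
  set η' := η / 3 with hη'
  -- Recession directions near the face have `e`-component at least `c / 2`, so a ray starting `δ`
  -- behind the face reaches its level within distance `η'`. With `η' = η / 3` the path stays within
  -- `η` of the face.
  set δ := min η' (η' * c / 2) with hδ
  have hη'0 : 0 < η' := by positivity
  have hδ0 : 0 < δ := by positivity
  have hδ1 : δ ≤ η' := min_le_left _ _
  have hδ2 : δ ≤ η' * c / 2 := min_le_right _ _
  -- a path passing behind the minimal face
  let r : ℝ → E3 := fun θ => s₂ + θ • (s₁ - s₂) + ((1 - 2 * θ) * η') • f - δ • e
  have hrc : Continuous r := by fun_prop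
  have hru : ∀ θ, ⟪r θ, (u : E3)⟫ = 0 := fun θ => by
    simp only [r, inner_add_left, inner_sub_left, real_inner_smul_left, hs₁'.1.1, hs₂'.1.1, hF.eu,
      hF.nu]
    ring
  have hre : ∀ θ, ⟪r θ, e⟫ = x₀ - δ := fun θ => by
    simp only [r, inner_add_left, inner_sub_left, real_inner_smul_left, hs₁'.2, hs₂'.2, hF.ee,
      hF.ne]
    ring
  have hrf : ∀ θ, ⟪r θ, f⟫ = ⟪s₂, f⟫ + θ * (⟪s₁, f⟫ - ⟪s₂, f⟫) + (1 - 2 * θ) * η' := fun θ => by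
    simp only [r, inner_add_left, inner_sub_left, real_inner_smul_left, hF.nn, hF.en]
    ring
  have hrV : ∀ θ, V (r θ) ≠ u := by
    intro θ h
    have h1 := hmin' (r θ) (mem_baseSpace.2 ⟨by rw [real_inner_comm]; exact hru θ, h⟩)
    rw [hre] at h1
    linarith
  have hnear : ∀ θ, 0 ≤ θ → θ ≤ 1 → ∃ s ∈ T, ‖r θ - s‖ < η := by
    intro θ h0 h1
    refine ⟨s₂ + θ • (s₁ - s₂), hTcv.add_smul_sub_mem hs₂ hs₁ ⟨h0, h1⟩, ?_⟩
    have h2 : r θ - (s₂ + θ • (s₁ - s₂)) = ((1 - 2 * θ) * η') • f - δ • e := by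
      simp only [r]; abel
    rw [h2]
    refine (norm_sub_le _ _).trans_lt ?_
    rw [norm_smul, norm_smul, hF.norm_n, hF.norm_e, mul_one, mul_one, Real.norm_eq_abs,
      Real.norm_of_nonneg hδ0.le, abs_mul, abs_of_pos hη'0]
    have h3 : |1 - 2 * θ| ≤ 1 := abs_le.2 ⟨by linarith, by linarith⟩
    have h4 := mul_le_mul_of_nonneg_right h3 hη'0.le
    linarith
  -- Parameters `θ` for which some point of direction `V (r θ)`, within `η'` of `r θ` and on the
  -- line of `u^⊥` carrying the face, has `f`-coordinate in `P`. For closed `P` this is the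
  -- projection of a compact set.
  let Z : Set ℝ → Set ℝ := fun P =>
    Prod.fst '' ((Set.Icc (0 : ℝ) 1 ×ˢ Metric.closedBall (0 : E3) η') ∩
    ({a : ℝ × E3 | V (r a.1 + a.2) = V (r a.1)} ∩ {a : ℝ × E3 | ⟪r a.1 + a.2, e⟫ = x₀} ∩
      {a : ℝ × E3 | ⟪r a.1 + a.2, (u : E3)⟫ = 0} ∩ (fun a : ℝ × E3 => ⟪r a.1 + a.2, f⟫) ⁻¹' P))
  have hZcl : ∀ P, IsClosed P → IsClosed (Z P) := by
    intro P hPc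
    have h1 : Continuous fun a : ℝ × E3 => r a.1 + a.2 :=
      (hrc.comp continuous_fst).add continuous_snd
    have hi : ∀ w : E3, Continuous fun a : ℝ × E3 => ⟪r a.1 + a.2, w⟫ :=
      fun w => h1.inner continuous_const
    refine IsCompact.isClosed (IsCompact.image ?_ continuous_fst)
    refine (isCompact_Icc.prod (isCompact_closedBall _ _)).inter_right ?_
    refine IsClosed.inter (IsClosed.inter (IsClosed.inter ?_ ?_) ?_) ?_
    · exact isClosed_eq (hV.continuous.comp h1) (hV.continuous.comp (hrc.comp continuous_fst))
    · exact isClosed_eq (hi e) continuous_const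
    · exact isClosed_eq (hi u) continuous_const
    · exact hPc.preimage (hi f)
  have hZmem : ∀ P θ, θ ∈ Z P ↔ (0 ≤ θ ∧ θ ≤ 1) ∧ ∃ z : E3, ‖z‖ ≤ η' ∧ V (r θ + z) = V (r θ) ∧
      ⟪r θ + z, e⟫ = x₀ ∧ ⟪r θ + z, (u : E3)⟫ = 0 ∧ ⟪r θ + z, f⟫ ∈ P := by
    intro P θ
    constructor
    · rintro ⟨⟨θ', z⟩, ⟨⟨h1, h2⟩, ⟨⟨h3, h4⟩, h5⟩, h6⟩, rfl⟩
      exact ⟨h1, z, mem_closedBall_zero_iff.1 h2, h3, h4, h5, h6⟩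
    · rintro ⟨h1, z, h2, h3, h4, h5, h6⟩
      exact ⟨(θ, z), ⟨⟨h1, mem_closedBall_zero_iff.2 h2⟩, ⟨⟨h3, h4⟩, h5⟩, h6⟩, rfl⟩
  have hmeet : ∀ θ, 0 ≤ θ → θ ≤ 1 → ∃ z : E3, ‖z‖ ≤ η' ∧ V (r θ + z) = V (r θ) ∧
      ⟪r θ + z, e⟫ = x₀ ∧ ⟪r θ + z, (u : E3)⟫ = 0 := by
    intro θ h0 h1
    obtain ⟨s, hs, hrs⟩ := hnear θ h0 h1
    obtain ⟨hpos, hdir⟩ := hbound s hs _ hrs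
    obtain ⟨d, hd, hdu, hrec⟩ := exists_isRecessive hV hP hS hpos.ne'
    have hde := hdir d hd hdu hrec
    have hde0 : 0 < ⟪d, e⟫ := by linarith
    refine ⟨(δ / ⟪d, e⟫) • d, ?_, hrec _ (by positivity), ?_, ?_⟩
    · rw [norm_smul, hd, mul_one, Real.norm_of_nonneg (by positivity), div_le_iff₀ hde0]
      refine hδ2.trans ?_
      have := mul_le_mul_of_nonneg_left hde hη'0.le
      linarith
    · rw [inner_add_left, real_inner_smul_left, hre]
      field_simp
      ring
    · rw [inner_add_left, real_inner_smul_left, hru, hdu]; ring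
  have habs : ∀ z : E3, ‖z‖ ≤ η' → |⟪z, f⟫| ≤ η' := fun z hz => by
    have := abs_real_inner_le_norm z f
    rw [hF.norm_n, mul_one] at this
    exact this.trans hz
  -- points of the minimal line of `S_u` are determined by their coordinate along `f`
  have hTf : ∀ y : E3, ∀ θ, V y = V (r θ) → ⟪y, e⟫ = x₀ → ⟪y, (u : E3)⟫ = 0 →
      ⟪s₂, f⟫ ≤ ⟪y, f⟫ ∨ ⟪y, f⟫ ≤ ⟪s₁, f⟫ := by
    intro y θ hVy hye hyu
    by_contra! hcon
    have hlt : 0 < ⟪s₂, f⟫ - ⟪s₁, f⟫ := by linarith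
    have h1 : y = s₁ + ((⟪y, f⟫ - ⟪s₁, f⟫) / (⟪s₂, f⟫ - ⟪s₁, f⟫)) • (s₂ - s₁) := by
      apply hF.ext <;> simp only [inner_add_left, inner_sub_left, real_inner_smul_left, hye, hyu,
        hs₁'.1.1, hs₂'.1.1, hs₁'.2, hs₂'.2]
      · ring
      · ring
      · field_simp
        ring
    have h2 := hTcv.add_smul_sub_mem hs₁ hs₂ (t := (⟪y, f⟫ - ⟪s₁, f⟫) / (⟪s₂, f⟫ - ⟪s₁, f⟫))
      ⟨div_nonneg (by linarith) hlt.le, (div_le_one hlt).2 (by linarith)⟩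
    rw [← h1] at h2
    exact hrV θ (hVy ▸ ((hTmem y).1 h2).1.2)
  have hcover : Set.Icc (0 : ℝ) 1 ⊆ Z (Set.Ici ⟪s₂, f⟫) ∪ Z (Set.Iic ⟪s₁, f⟫) := by
    rintro θ ⟨h0, h1⟩
    obtain ⟨z, hz, hzV, hze, hzu⟩ := hmeet θ h0 h1
    rcases hTf _ θ hzV hze hzu with h | h
    · exact Or.inl ((hZmem _ _).2 ⟨⟨h0, h1⟩, z, hz, hzV, hze, hzu, h⟩)
    · exact Or.inr ((hZmem _ _).2 ⟨⟨h0, h1⟩, z, hz, hzV, hze, hzu, h⟩)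
  have hzero : (0 : ℝ) ∈ Z (Set.Ici ⟪s₂, f⟫) := by
    obtain ⟨z, hz, hzV, hze, hzu⟩ := hmeet 0 le_rfl zero_le_one
    refine (hZmem _ _).2 ⟨⟨le_rfl, zero_le_one⟩, z, hz, hzV, hze, hzu, ?_⟩
    rw [Set.mem_Ici, inner_add_left, hrf]
    linarith [(abs_le.1 (habs z hz)).1]
  have hone : (1 : ℝ) ∈ Z (Set.Iic ⟪s₁, f⟫) := by
    obtain ⟨z, hz, hzV, hze, hzu⟩ := hmeet 1 zero_le_one le_rfl
    refine (hZmem _ _).2 ⟨⟨zero_le_one, le_rfl⟩, z, hz, hzV, hze, hzu, ?_⟩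
    rw [Set.mem_Iic, inner_add_left, hrf]
    linarith [(abs_le.1 (habs z hz)).2]
  -- The path starts `η'` beyond `s₂` and ends `η'` beyond `s₁`, which decides the side at both
  -- ends. At a common `θ` two points of direction `V (r θ)` have `s₁` between them, although `V s₁
  -- = u`.
  obtain ⟨θ, -, hθ, hθ'⟩ := isPreconnected_closed_iff.1 (isPreconnected_Icc (a := (0 : ℝ)) (b := 1))
    _ _ (hZcl _ isClosed_Ici) (hZcl _ isClosed_Iic) hcover
    ⟨0, ⟨le_rfl, zero_le_one⟩, hzero⟩ ⟨1, ⟨zero_le_one, le_rfl⟩, hone⟩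
  obtain ⟨-, z, -, hzV, hze, hzu, hzf⟩ := (hZmem _ _).1 hθ
  obtain ⟨-, z', -, hzV', hze', hzu', hzf'⟩ := (hZmem _ _).1 hθ'
  set y := r θ + z with hy
  set y' := r θ + z' with hy'
  rw [Set.mem_Ici] at hzf
  rw [Set.mem_Iic] at hzf'
  have hcontra : V s₁ ≠ V (r θ) := by rw [hs₁'.1.2]; exact (hrV θ).symm
  rcases (hzf'.trans (h12.trans hzf)).eq_or_lt with heq | hlt
  · apply hcontra
    rw [← hzV]
    congr 1
    exact hF.ext (by rw [hs₁'.1.1, hzu]) (by rw [hs₁'.2, hze]) (by linarith)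
  · apply hcontra
    have h1 := eq_of_between hV hP (hzV'.trans hzV.symm)
      (c := (⟪s₁, f⟫ - ⟪y', f⟫) / (⟪y, f⟫ - ⟪y', f⟫)) (div_nonneg (by linarith) (by linarith))
      ((div_le_one (by linarith)).2 (by linarith))
    have h2 : s₁ = y' + ((⟪s₁, f⟫ - ⟪y', f⟫) / (⟪y, f⟫ - ⟪y', f⟫)) • (y - y') := by
      have hne : ⟪y, f⟫ - ⟪y', f⟫ ≠ 0 := by linarith
      apply hF.ext <;> simp only [inner_add_left, inner_sub_left, real_inner_smul_left, hze, hzu,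
        hze', hzu', hs₁'.1.1, hs₁'.2]
      · ring
      · ring
      · field_simp
        ring
    rw [h2, h1, hzV']

/-! ### Unions of lines and the final assembly -/

/-- In a planar fibration the base spaces are unions of lines. -/
lemma IsPlanar.isUnionOfLines (hV : IsLineFibration V) (h : IsPlanar V) {u : S2}
    (hu : u ∈ directions V) : IsUnionOfLines (baseSpace V u) := by
  obtain ⟨e, he, h⟩ := h.exists_line hV hu
  have he0 : e ≠ 0 := by rintro rfl; simp at he
  refine ⟨(fun p => AffineSubspace.mk' p (ℝ ∙ e)) '' baseSpace V u,
    (baseSpace_nonempty hV hu).image _, ?_, ?_⟩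
  · rintro _ ⟨p, -, rfl⟩
    refine ⟨⟨p, AffineSubspace.self_mem_mk' _ _⟩, ?_⟩
    rw [AffineSubspace.direction_mk', finrank_span_singleton he0]
  · ext y
    simp only [Set.mem_iUnion, Set.mem_image, exists_prop, exists_exists_and_eq_and]
    constructor
    · exact fun hy => ⟨y, hy, AffineSubspace.self_mem_mk' _ _⟩
    · rintro ⟨p, hp, hy⟩
      rw [SetLike.mem_coe, AffineSubspace.mem_mk', vsub_eq_sub, Submodule.mem_span_singleton] at hy
      obtain ⟨x, hx⟩ := hy
      have h1 := h p hp x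
      rwa [hx, add_sub_cancel] at h1

end LineFibration

theorem theorem1 (V : LineFibration.E3 → LineFibration.S2)
    (hV : LineFibration.IsLineFibration V) :
    (¬ LineFibration.IsOneParameter V →
      ∀ u ∈ LineFibration.directions V,
        Convex ℝ (LineFibration.baseSpace V u) ∧ IsConnected (LineFibration.baseSpace V u)) ∧
    (∀ u ∈ LineFibration.directions V, IsCompact (LineFibration.baseSpace V u) →
      LineFibration.ContinuityAtInfinity V u ∧ -u ∉ LineFibration.directions V) ∧
    ((∀ u ∈ LineFibration.directions V, IsCompact (LineFibration.baseSpace V u)) →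
      LineFibration.IsSphericallyConvex (LineFibration.directions V)) ∧
    ((∀ u ∈ LineFibration.directions V, ¬ IsCompact (LineFibration.baseSpace V u)) →
      (∀ u ∈ LineFibration.directions V,
        LineFibration.IsUnionOfLines (LineFibration.baseSpace V u)) ∧
      LineFibration.IsOneParameter V) := by
  refine ⟨fun h u hu => ?_, fun u hu hK => ?_, fun hK => ?_, fun hS => ?_⟩
  · have hc := LineFibration.convex_baseSpace hV (fun hP => h hP.isOneParameter) u
    exact ⟨hc, LineFibration.baseSpace_nonempty hV hu, hc.isPreconnected⟩
  · exact ⟨LineFibration.continuityAtInfinity_of_isCompact hV hu hK,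
      LineFibration.neg_notMem_directions hV hu hK⟩
  · exact LineFibration.isSphericallyConvex_directions hV hK
  · have hP := LineFibration.isPlanar_of_forall_not_isCompact hV hS
    exact ⟨fun u hu => hP.isUnionOfLines hV hu, hP.isOneParameter⟩
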